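/- Let $n\ge 2$. For $h,k\in\mathbb N$, an $(h,k)$-strand diagram is a finite acyclic directed graph embedded (up to isotopy) in the unit square, with $h$ univalent sources along the top and $k$ univalent sinks along the bottom, all of whose other vertices are splits (one incoming and $n$ outgoing edges) or merges ($n$ incoming and one outgoing edge). A reduction of type I deletes a split and a merge that are joined by $n$ parallel edges (the $i$-th edge out of the split being the $i$-th edge into the merge, for all $i$), and joins the edge into the split to the edge out of the merge. A reduction of type II deletes a merge and a split such that the edge out of the merge is the edge into the split, and joins, for each $i$, the $i$-th edge into the merge to the $i$-th edge out of the split. A diagram is reduced if neither reduction can be applied to it; two $(h,k)$-strand diagrams are equivalent if they are connected by a finite sequence of reductions and inverse reductions. The equivalence classes $[A]$ form a groupoid over the positive integers, with product $[A][B]=[AB]$, where $AB$ is the concatenation ($A$ on top of $B$, the sinks of $A$ glued to the sources of $B$), and with $[A]^{-1}$ the class of the reflection of $A$ in a horizontal line. The Brown–Thompson group $F_n$ is identified with the isotropy group of this groupoid at $1$, i.e. with the set of classes of $(1,1)$-strand diagrams. **Theorem.** For every $g\in F_n$ there are an integer $m\ge 1$, a $(1,m)$-strand diagram $S$ and an $(m,m)$-strand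 diagram $E_g$ such that $$g=[S]\,[E_g]\,[S]^{-1},$$ $E_g$ is reduced, the concatenation $E_gE_g$ of two copies of $E_g$ is (without performing any reduction) already reduced, and, more generally, for every $p\ge 0$ the concatenation $E_g^p$ of $p$ copies of $E_g$ is already reduced (where $E_g^0$ is the trivial diagram of $m$ parallel strands). -/

import Mathlib

/-- Tails of edges of a strand diagram: an edge starts at one of the `h` sources (numbered from
left to right), at one of the `n` outgoing ports of a split (numbered from left to right), or at the
only outgoing port of a merge. As every port carries exactly one edge, this type also serves as the
type of edges. -/
inductive Tail (n h : ℕ) (S M : Type) : Type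
  | source (i : Fin h)
  | ofSplit (s : S) (i : Fin n)
  | ofMerge (m : M)

/-- Heads of edges of a strand diagram: an edge ends at one of the `k` sinks (numbered from
left to right), at the only incoming port of a split, or at one of the `n` incoming ports of a merge
(numbered from left to right). -/
inductive Head (n k : ℕ) (S M : Type) : Type
  | sink (j : Fin k)
  | toSplit (s : S)
  | toMerge (m : M) (i : Fin n)

/-- Renaming the vertices. -/
def Tail.map {n h : ℕ} {S M S' M' : Type} (f : S → S') (g : M → M') :
    Tail n h S M → Tail n h S' M'
  | .source i => .source i
  | .ofSplit s i => .ofSplit (f s) i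
  | .ofMerge m => .ofMerge (g m)

/-- Renaming the vertices. -/
def Head.map {n k : ℕ} {S M S' M' : Type} (f : S → S') (g : M → M') :
    Head n k S M → Head n k S' M'
  | .sink j => .sink j
  | .toSplit s => .toSplit (f s)
  | .toMerge m i => .toMerge (g m) i

/-- The vertex at which an edge starts, if it is not a source. -/
def Tail.vertex? {n h : ℕ} {S M : Type} : Tail n h S M → Option (S ⊕ M)
  | .source _ => none
  | .ofSplit s _ => some (.inl s)
  | .ofMerge m => some (.inr m)

/-- The vertex at which an edge ends, if it is not a sink. -/
def Head.vertex? {n k : ℕ} {S M : Type} : Head n k S M → Option (S ⊕ M)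
  | .sink _ => none
  | .toSplit s => some (.inl s)
  | .toMerge m _ => some (.inr m)

/-- There is an edge from the vertex `u` to the vertex `v`. -/
def EdgeRel {n h k : ℕ} {S M : Type} (wire : Tail n h S M ≃ Head n k S M) (u v : S ⊕ M) : Prop :=
  ∃ t : Tail n h S M, t.vertex? = some u ∧ (wire t).vertex? = some v

/-- Moving a horizontal line downwards over a drawing of the diagram in which all edges descend.
`Sweep wire vs L L'` says: from a position in which the line crosses the edges `L`, listed
from left to right, it can be moved down past the vertices `vs`, one after the other, to a
position in which it crosses the edges `L'`. When the line passes a split, the edge that enters the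
split is replaced, at the same place, by the `n` edges that leave it, in their left-to-right order;
when it passes a merge, the `n` edges that enter the merge have to be consecutive and in their
left-to-right order, and are replaced by the edge that leaves it. -/
inductive Sweep {n h k : ℕ} {S M : Type} (wire : Tail n h S M ≃ Head n k S M) :
    List (S ⊕ M) → List (Tail n h S M) → List (Tail n h S M) → Prop
  | nil (L : List (Tail n h S M)) : Sweep wire [] L L
  | split (s : S) (vs : List (S ⊕ M)) (L R L' : List (Tail n h S M))
      (hs : Sweep wire vs (L ++ List.ofFn (fun i => Tail.ofSplit s i) ++ R) L') :
      Sweep wire (Sum.inl s :: vs) (L ++ [wire.symm (Head.toSplit s)] ++ R) L'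
  | merge (m : M) (vs : List (S ⊕ M)) (L R L' : List (Tail n h S M))
      (hm : Sweep wire vs (L ++ [Tail.ofMerge m] ++ R) L') :
      Sweep wire (Sum.inr m :: vs)
        (L ++ List.ofFn (fun i => wire.symm (Head.toMerge m i)) ++ R) L'

/-- The graph is drawn in the square, without crossings, with the prescribed left-to-right orders
at the vertices, at the top side and at the bottom side: a horizontal line can be swept
from the top, where it crosses the edges at the sources in order, to the bottom, where it crosses
the edges at the sinks in order, passing each vertex exactly once. -/
def PlaneWiring {n h k : ℕ} {S M : Type} (wire : Tail n h S M ≃ Head n k S M) : Prop :=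
  ∃ vs : List (S ⊕ M), vs.Nodup ∧ (∀ v, v ∈ vs) ∧
    Sweep wire vs (List.ofFn (fun i => Tail.source i))
      (List.ofFn (fun j => wire.symm (Head.sink j)))

/-- An `(h, k)`-strand diagram of arity `n`: a finite acyclic directed graph embedded in the square,
with `h` univalent sources on the top side and `k` univalent sinks on the bottom side,
whose other vertices are splits (one edge in, `n` edges out) and merges (`n` edges in, one edge
out). The embedding matters only up to isotopy, and is recorded by the left-to-right
orders at the vertices and on the two sides, with the condition that they come from a
plane drawing. -/
structure StrandDiagram (n h k : ℕ) where
  /-- the splits -/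
  Split : Type
  /-- the merges -/
  Merge : Type
  finite_split : Finite Split
  finite_merge : Finite Merge
  /-- the edges: each tail is joined to one head -/
  wire : Tail n h Split Merge ≃ Head n k Split Merge
  acyclic : ∀ v, ¬ Relation.TransGen (EdgeRel wire) v v
  plane : PlaneWiring wire

namespace StrandDiagram

variable {n h k l : ℕ}

/-- Isotopy of strand diagrams: an isomorphism of directed graphs that respects
sources, sinks and all left-to-right orders. Isotopic diagrams are regarded as equal. -/
def Isotopic (A B : StrandDiagram n h k) : Prop :=
  ∃ (σ : A.Split ≃ B.Split) (μ : A.Merge ≃ B.Merge),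
    ∀ t, B.wire (t.map σ μ) = (A.wire t).map σ μ

/-- The configuration of a type I move: the `n` edges that leave the split `s` are parallel and
are the `n` edges that enter the merge `m`. -/
def IsSplitMerge (A : StrandDiagram n h k) (s : A.Split) (m : A.Merge) : Prop :=
  ∀ i, A.wire (.ofSplit s i) = .toMerge m i

/-- The configuration of a type II move: the edge that leaves the merge `m` is the edge that
enters the split `s`. -/
def IsMergeSplit (A : StrandDiagram n h k) (m : A.Merge) (s : A.Split) : Prop :=
  A.wire (.ofMerge m) = .toSplit s

/-- `f` identifies `X` with `Y` minus the point `y`. -/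
def Deletes {X Y : Type} (f : X → Y) (y : Y) : Prop :=
  Function.Injective f ∧ ∀ x, (x ∈ Set.range f ↔ x ≠ y)

/-- `B` arises from `A` by a reduction of type I: a split `s` and a merge `m` that are joined by
`n` parallel edges are deleted together with these edges, and the edge into `s` is
continued by the edge out of `m`. -/
def ReducesI (A B : StrandDiagram n h k) : Prop :=
  ∃ (s : A.Split) (m : A.Merge) (σ : B.Split → A.Split) (μ : B.Merge → A.Merge),
    A.IsSplitMerge s m ∧ Deletes σ s ∧ Deletes μ m ∧
    ∀ t, A.wire (t.map σ μ) = (B.wire t).map σ μ ∨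
      (A.wire (t.map σ μ) = .toSplit s ∧ A.wire (.ofMerge m) = (B.wire t).map σ μ)

/-- `B` arises from `A` by a reduction of type II: a merge `m` and a split `s` that are joined by
an edge from `m` to `s` are deleted together with this edge, and for each `i` the `i`-th edge
into `m` is continued by the `i`-th edge out of `s`. -/
def ReducesII (A B : StrandDiagram n h k) : Prop :=
  ∃ (s : A.Split) (m : A.Merge) (σ : B.Split → A.Split) (μ : B.Merge → A.Merge),
    A.IsMergeSplit m s ∧ Deletes σ s ∧ Deletes μ m ∧
    ∀ t, A.wire (t.map σ μ) = (B.wire t).map σ μ ∨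
      ∃ i, A.wire (t.map σ μ) = .toMerge m i ∧ A.wire (.ofSplit s i) = (B.wire t).map σ μ

/-- A strand diagram is reduced if neither kind of reduction can be applied. -/
def Reduced (A : StrandDiagram n h k) : Prop :=
  (∀ s m, ¬ A.IsSplitMerge s m) ∧ (∀ m s, ¬ A.IsMergeSplit m s)

/-- One step between strand diagrams: an isotopy or a reduction. -/
def Step (A B : StrandDiagram n h k) : Prop :=
  Isotopic A B ∨ ReducesI A B ∨ ReducesII A B

/-- Equivalence of strand diagrams: a sequence of isotopies, reductions and inverse reductions. -/
def equivalence (n h k : ℕ) : Setoid (StrandDiagram n h k) := Relation.EqvGen.setoid Step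


/-- The trivial diagram: `k` parallel vertical edges. -/
def one (n k : ℕ) : StrandDiagram n k k where
  Split := Empty
  Merge := Empty
  finite_split := inferInstance
  finite_merge := inferInstance
  wire :=
    { toFun := fun t => match t with
        | .source i => .sink i
      invFun := fun t => match t with
        | .sink i => .source i
      left_inv := by rintro (i | ⟨⟨⟩, _⟩ | ⟨⟨⟩⟩); rfl
      right_inv := by rintro (i | ⟨⟨⟩⟩ | ⟨⟨⟩, _⟩); rfl }
  acyclic := by rintro (⟨⟨⟩⟩ | ⟨⟨⟩⟩)
  plane := ⟨[], List.nodup_nil, by rintro (⟨⟨⟩⟩ | ⟨⟨⟩⟩), Sweep.nil _⟩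

section Reflect

variable {S M : Type}

/-- Reflection of ports: tails become heads, splits become merges. -/
def reflectTail : Tail n h S M ≃ Head n h M S where
  toFun
    | .source i => .sink i
    | .ofSplit s i => .toMerge s i
    | .ofMerge m => .toSplit m
  invFun
    | .sink i => .source i
    | .toMerge s i => .ofSplit s i
    | .toSplit m => .ofMerge m
  left_inv := by rintro (_ | _ | _) <;> rfl
  right_inv := by rintro (_ | _ | _) <;> rfl

/-- The wiring of the mirror image in a horizontal line, with all arrows reversed. -/
def reflectWire (wire : Tail n h S M ≃ Head n k S M) : Tail n k M S ≃ Head n h M S :=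
  (reflectTail.trans (wire.symm.trans reflectTail) : Tail n k M S ≃ Head n h M S)

theorem sweep_trans {wire : Tail n h S M ≃ Head n k S M} {vs ws : List (S ⊕ M)}
    {L L' L'' : List (Tail n h S M)} (h₁ : Sweep wire vs L L') (h₂ : Sweep wire ws L' L'') :
    Sweep wire (vs ++ ws) L L'' := by
  induction h₁ with
  | nil L => exact h₂
  | split s vs L R L' _ ih => exact Sweep.split s _ L R _ (ih h₂)
  | merge m vs L R L' _ ih => exact Sweep.merge m _ L R _ (ih h₂)

theorem sweep_reflect {wire : Tail n h S M ≃ Head n k S M} {vs : List (S ⊕ M)}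
    {L L' : List (Tail n h S M)} (hs : Sweep wire vs L L') :
    Sweep (reflectWire wire) (vs.reverse.map Sum.swap)
      (L'.map fun t => reflectTail.symm (wire t)) (L.map fun t => reflectTail.symm (wire t)) := by
  induction hs with
  | nil L => exact Sweep.nil _
  | split s vs L R L' _ ih =>
    rw [List.reverse_cons, List.map_append]
    refine sweep_trans ih ?_
    have := Sweep.merge (wire := reflectWire wire) s []
      (L.map fun t => reflectTail.symm (wire t)) (R.map fun t => reflectTail.symm (wire t))
      _ (Sweep.nil _)
    simpa [reflectWire, reflectTail, List.map_ofFn, Function.comp_def] using this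
  | merge m vs L R L' _ ih =>
    rw [List.reverse_cons, List.map_append]
    refine sweep_trans ih ?_
    have := Sweep.split (wire := reflectWire wire) m []
      (L.map fun t => reflectTail.symm (wire t)) (R.map fun t => reflectTail.symm (wire t))
      _ (Sweep.nil _)
    simpa [reflectWire, reflectTail, List.map_ofFn, Function.comp_def] using this

theorem plane_reflect {wire : Tail n h S M ≃ Head n k S M} (hw : PlaneWiring wire) :
    PlaneWiring (reflectWire wire) := by
  obtain ⟨vs, hd, hall, hs⟩ := hw
  refine ⟨vs.reverse.map Sum.swap, ?_, ?_, ?_⟩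
  · exact (List.nodup_reverse.2 hd).map Sum.swap_leftInverse.injective
  · intro v
    exact List.mem_map.2 ⟨v.swap, List.mem_reverse.2 (hall _), v.swap_swap⟩
  · simpa [reflectWire, reflectTail, List.map_ofFn, Function.comp_def] using sweep_reflect hs

theorem edgeRel_reflect {wire : Tail n h S M ≃ Head n k S M} {u v : M ⊕ S}
    (hr : EdgeRel (reflectWire wire) u v) : EdgeRel wire v.swap u.swap := by
  obtain ⟨t, ht, hv⟩ := hr
  refine ⟨wire.symm (reflectTail t), ?_, ?_⟩
  · simp only [reflectWire, Equiv.trans_apply] at hv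
    generalize wire.symm (reflectTail t) = x at hv
    rcases x with _ | _ | _ <;> rcases v with _ | _ <;>
      simp_all [reflectTail, Tail.vertex?, Head.vertex?]
  · rw [Equiv.apply_symm_apply]
    rcases t with _ | _ | _ <;> rcases u with _ | _ <;>
      simp_all [reflectTail, Tail.vertex?, Head.vertex?]

end Reflect

/-- The inverse diagram: reflection in a horizontal line. -/
def reflect (A : StrandDiagram n h k) : StrandDiagram n k h where
  Split := A.Merge
  Merge := A.Split
  finite_split := A.finite_merge
  finite_merge := A.finite_split
  wire := reflectWire A.wire
  acyclic := fun v hv => A.acyclic v.swap (by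
    have hsw := Relation.transGen_swap.2 hv
    exact hsw.lift Sum.swap (fun _ _ hab => edgeRel_reflect hab))
  plane := plane_reflect A.plane

section Concat

variable {S M S' M' : Type}

/-- An edge of the upper diagram, as an edge of the concatenation. -/
def upperTail : Tail n h S M → Tail n h (S ⊕ S') (M ⊕ M') :=
  Tail.map Sum.inl Sum.inl

/-- A head in the lower diagram, as a head in the concatenation. -/
def lowerHead : Head n l S' M' → Head n l (S ⊕ S') (M ⊕ M') :=
  Head.map Sum.inr Sum.inr

/-- An edge of the lower diagram starts in the concatenation where it did, except that an edge
from the `j`-th source is glued to the edge of the upper diagram that goes to the `j`-th sink. -/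
def lowerTail (a : Tail n h S M ≃ Head n k S M) :
    Tail n k S' M' → Tail n h (S ⊕ S') (M ⊕ M')
  | .source j => upperTail (a.symm (.sink j))
  | .ofSplit s i => .ofSplit (.inr s) i
  | .ofMerge m => .ofMerge (.inr m)

/-- An edge of the upper diagram ends in the concatenation where it did, except that an edge to
the `j`-th sink is glued to the edge of the lower diagram that starts at the `j`-th source. -/
def upperHead (b : Tail n k S' M' ≃ Head n l S' M') :
    Head n k S M → Head n l (S ⊕ S') (M ⊕ M')
  | .sink j => lowerHead (b (.source j))
  | .toSplit s => .toSplit (.inl s)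
  | .toMerge m i => .toMerge (.inl m) i

/-- The wiring of a concatenation. -/
def concatWire (a : Tail n h S M ≃ Head n k S M) (b : Tail n k S' M' ≃ Head n l S' M') :
    Tail n h (S ⊕ S') (M ⊕ M') ≃ Head n l (S ⊕ S') (M ⊕ M') where
  toFun
    | .source i => upperHead b (a (.source i))
    | .ofSplit (.inl s) i => upperHead b (a (.ofSplit s i))
    | .ofMerge (.inl m) => upperHead b (a (.ofMerge m))
    | .ofSplit (.inr s) i => lowerHead (b (.ofSplit s i))
    | .ofMerge (.inr m) => lowerHead (b (.ofMerge m))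
  invFun
    | .sink j => lowerTail a (b.symm (.sink j))
    | .toSplit (.inr s) => lowerTail a (b.symm (.toSplit s))
    | .toMerge (.inr m) i => lowerTail a (b.symm (.toMerge m i))
    | .toSplit (.inl s) => upperTail (a.symm (.toSplit s))
    | .toMerge (.inl m) i => upperTail (a.symm (.toMerge m i))
  left_inv := by
    have key : ∀ t, (match upperHead b (a t) with
        | .sink j => lowerTail a (b.symm (.sink j))
        | .toSplit (.inr s) => lowerTail a (b.symm (.toSplit s))
        | .toMerge (.inr m) i => lowerTail a (b.symm (.toMerge m i))
        | .toSplit (.inl s) => upperTail (a.symm (.toSplit s))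
        | .toMerge (.inl m) i => upperTail (a.symm (.toMerge m i)) :
        Tail n h (S ⊕ S') (M ⊕ M')) = upperTail t := by
      intro t
      rcases ha : a t with j | s | ⟨m, i⟩ <;> have ha' := a.symm_apply_eq.2 ha.symm
      · rcases hb : b (.source j) with j' | s | ⟨m, i⟩ <;>
          have hb' := b.symm_apply_eq.2 hb.symm <;>
          simp [upperHead, lowerHead, Head.map, hb, hb', lowerTail, ha']
      · simp [upperHead, ha']
      · simp [upperHead, ha']
    rintro (i | ⟨s | s, i⟩ | (m | m))
    · exact key _
    · exact key _
    · rcases hb : b (.ofSplit s i) with j' | s | ⟨m, i⟩ <;>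
        have hb' := b.symm_apply_eq.2 hb.symm <;>
        simp [lowerHead, Head.map, hb, hb', lowerTail]
    · exact key _
    · rcases hb : b (.ofMerge m) with j' | s | ⟨m, i⟩ <;>
        have hb' := b.symm_apply_eq.2 hb.symm <;>
        simp [lowerHead, Head.map, hb, hb', lowerTail]
  right_inv := by
    have key : ∀ t, (match lowerTail a (b.symm t) with
        | .source i => upperHead b (a (.source i))
        | .ofSplit (.inl s) i => upperHead b (a (.ofSplit s i))
        | .ofMerge (.inl m) => upperHead b (a (.ofMerge m))
        | .ofSplit (.inr s) i => lowerHead (b (.ofSplit s i))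
        | .ofMerge (.inr m) => lowerHead (b (.ofMerge m)) :
        Head n l (S ⊕ S') (M ⊕ M')) = lowerHead t := by
      intro t
      rcases hb : b.symm t with j | ⟨s, i⟩ | m <;> have hb' := b.symm_apply_eq.1 hb
      · rcases ha : a.symm (.sink j) with j' | ⟨s, i⟩ | m <;>
          have ha' := a.symm_apply_eq.1 ha <;>
          simp [lowerTail, upperTail, Tail.map, ha, ← ha', upperHead, ← hb']
      · simp [lowerTail, ← hb']
      · simp [lowerTail, ← hb']
    rintro (j | (s | s) | ⟨m | m, i⟩)
    · exact key _
    · rcases ha : a.symm (.toSplit s) with j' | ⟨s, i⟩ | m <;>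
        have ha' := a.symm_apply_eq.1 ha <;>
        simp [upperTail, Tail.map, ha, ← ha', upperHead]
    · exact key _
    · rcases ha : a.symm (.toMerge m i) with j' | ⟨s, i⟩ | m <;>
        have ha' := a.symm_apply_eq.1 ha <;>
        simp [upperTail, Tail.map, ha, ← ha', upperHead]
    · exact key _

theorem sweep_upper {a : Tail n h S M ≃ Head n k S M} (b : Tail n k S' M' ≃ Head n l S' M')
    {vs : List (S ⊕ M)} {L L' : List (Tail n h S M)} (hs : Sweep a vs L L') :
    Sweep (concatWire a b) (vs.map (Sum.map Sum.inl Sum.inl))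
      (L.map upperTail) (L'.map upperTail) := by
  induction hs with
  | nil L => exact Sweep.nil _
  | split s vs L R L' _ ih =>
    have := Sweep.split (wire := concatWire a b) (.inl s) (vs.map (Sum.map Sum.inl Sum.inl))
      (L.map upperTail) (R.map upperTail) (L'.map upperTail)
      (by simpa [upperTail, Tail.map, List.map_ofFn, Function.comp_def] using ih)
    simpa [concatWire] using this
  | merge m vs L R L' _ ih =>
    have := Sweep.merge (wire := concatWire a b) (.inl m) (vs.map (Sum.map Sum.inl Sum.inl))
      (L.map upperTail) (R.map upperTail) (L'.map upperTail)
      (by simpa [upperTail, Tail.map] using ih)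
    simpa [concatWire, List.map_ofFn, Function.comp_def] using this

theorem sweep_lower (a : Tail n h S M ≃ Head n k S M) {b : Tail n k S' M' ≃ Head n l S' M'}
    {vs : List (S' ⊕ M')} {L L' : List (Tail n k S' M')} (hs : Sweep b vs L L') :
    Sweep (concatWire a b) (vs.map (Sum.map Sum.inr Sum.inr))
      (L.map (lowerTail a)) (L'.map (lowerTail a)) := by
  induction hs with
  | nil L => exact Sweep.nil _
  | split s vs L R L' _ ih =>
    have := Sweep.split (wire := concatWire a b) (.inr s) (vs.map (Sum.map Sum.inr Sum.inr))
      (L.map (lowerTail a)) (R.map (lowerTail a)) (L'.map (lowerTail a))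
      (by simpa [lowerTail, List.map_ofFn, Function.comp_def] using ih)
    simpa [concatWire] using this
  | merge m vs L R L' _ ih =>
    have := Sweep.merge (wire := concatWire a b) (.inr m) (vs.map (Sum.map Sum.inr Sum.inr))
      (L.map (lowerTail a)) (R.map (lowerTail a)) (L'.map (lowerTail a))
      (by simpa [lowerTail] using ih)
    simpa [concatWire, List.map_ofFn, Function.comp_def] using this

theorem plane_concat {a : Tail n h S M ≃ Head n k S M} {b : Tail n k S' M' ≃ Head n l S' M'}
    (ha : PlaneWiring a) (hb : PlaneWiring b) : PlaneWiring (concatWire a b) := by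
  obtain ⟨vs, hd, hall, hs⟩ := ha
  obtain ⟨ws, hd', hall', hs'⟩ := hb
  refine ⟨vs.map (Sum.map Sum.inl Sum.inl) ++ ws.map (Sum.map Sum.inr Sum.inr), ?_, ?_, ?_⟩
  · refine List.nodup_append.2 ⟨hd.map ?_, hd'.map ?_, ?_⟩
    · exact Sum.map_injective.2 ⟨Sum.inl_injective, Sum.inl_injective⟩
    · exact Sum.map_injective.2 ⟨Sum.inr_injective, Sum.inr_injective⟩
    · simp
  · rintro ((s | s) | (m | m)) <;> simp [hall, hall']
  · have h₁ := sweep_upper b hs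
    have h₂ := sweep_lower a hs'
    have e₁ : (List.ofFn fun j : Fin k => a.symm (Head.sink j)).map
        (upperTail (S' := S') (M' := M')) =
        (List.ofFn fun j : Fin k => Tail.source j).map (lowerTail a) := by
      simp [List.map_ofFn, Function.comp_def, lowerTail]
    rw [e₁] at h₁
    have := sweep_trans h₁ h₂
    simpa [List.map_ofFn, Function.comp_def, upperTail, Tail.map, concatWire] using this

theorem concatWire_upper (a : Tail n h S M ≃ Head n k S M) (b : Tail n k S' M' ≃ Head n l S' M')
    (t : Tail n h S M) : concatWire a b (upperTail t) = upperHead b (a t) := by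
  rcases t with _ | _ | _ <;> rfl

theorem concatWire_lower (a : Tail n h S M ≃ Head n k S M) (b : Tail n k S' M' ≃ Head n l S' M')
    (t : Tail n k S' M') : concatWire a b (lowerTail a t) = lowerHead (b t) := by
  rcases t with i | ⟨s, i⟩ | m
  · simp [lowerTail, concatWire_upper, upperHead]
  · rfl
  · rfl

/-- How the starting and end points of a path lie in a concatenation. -/
theorem transGen_concat {a : Tail n h S M ≃ Head n k S M} {b : Tail n k S' M' ≃ Head n l S' M'}
    {u v : (S ⊕ S') ⊕ (M ⊕ M')} (hr : Relation.TransGen (EdgeRel (concatWire a b)) u v) :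
    (∃ u' v', u = Sum.map Sum.inl Sum.inl u' ∧ v = Sum.map Sum.inl Sum.inl v' ∧
      Relation.TransGen (EdgeRel a) u' v') ∨
    (∃ u' v', u = Sum.map Sum.inl Sum.inl u' ∧ v = Sum.map Sum.inr Sum.inr v') ∨
    (∃ u' v', u = Sum.map Sum.inr Sum.inr u' ∧ v = Sum.map Sum.inr Sum.inr v' ∧
      Relation.TransGen (EdgeRel b) u' v') := by
  have vU : ∀ t : Tail n h S M, (upperTail (S' := S') (M' := M') t).vertex? =
      t.vertex?.map (Sum.map Sum.inl Sum.inl) := by rintro (_ | _ | _) <;> rfl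
  have vL : ∀ t : Head n l S' M', (lowerHead (S := S) (M := M) t).vertex? =
      t.vertex?.map (Sum.map Sum.inr Sum.inr) := by rintro (_ | _ | _) <;> rfl
  have up : ∀ (t : Tail n h S M) v, (concatWire a b (upperTail t)).vertex? = some v →
      (∃ v', v = Sum.map Sum.inl Sum.inl v' ∧ (a t).vertex? = some v') ∨
      (∃ v', v = Sum.map Sum.inr Sum.inr v') := by
    intro t v ht
    rw [concatWire_upper] at ht
    generalize a t = x at ht ⊢
    rcases x with j | s | ⟨m, i⟩
    · simp only [upperHead, vL, Option.map_eq_some_iff] at ht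
      obtain ⟨v', -, rfl⟩ := ht
      exact Or.inr ⟨v', rfl⟩
    · simp only [upperHead, Head.vertex?, Option.some.injEq] at ht
      exact Or.inl ⟨.inl s, ht.symm, rfl⟩
    · simp only [upperHead, Head.vertex?, Option.some.injEq] at ht
      exact Or.inl ⟨.inr m, ht.symm, rfl⟩
  have step : ∀ {u v : (S ⊕ S') ⊕ (M ⊕ M')}, EdgeRel (concatWire a b) u v →
      (∃ u', u = Sum.map Sum.inl Sum.inl u' ∧
        ((∃ v', v = Sum.map Sum.inl Sum.inl v' ∧ EdgeRel a u' v') ∨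
          ∃ v', v = Sum.map Sum.inr Sum.inr v')) ∨
      (∃ u' v', u = Sum.map Sum.inr Sum.inr u' ∧ v = Sum.map Sum.inr Sum.inr v' ∧
        EdgeRel b u' v') := by
    rintro u v ⟨t, hu, hv⟩
    have upper : ∀ t' : Tail n h S M, t = upperTail t' → ∃ u', u = Sum.map Sum.inl Sum.inl u' ∧
        ((∃ v', v = Sum.map Sum.inl Sum.inl v' ∧ EdgeRel a u' v') ∨
          ∃ v', v = Sum.map Sum.inr Sum.inr v') := by
      rintro t' rfl
      rw [vU, Option.map_eq_some_iff] at hu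
      obtain ⟨u', hu', rfl⟩ := hu
      refine ⟨u', rfl, ?_⟩
      rcases up _ _ hv with ⟨v', rfl, hv'⟩ | hv'
      · exact Or.inl ⟨v', rfl, t', hu', hv'⟩
      · exact Or.inr hv'
    have lower : ∀ (t' : Tail n k S' M') u', t = lowerTail a t' → t'.vertex? = some u' →
        u = Sum.map Sum.inr Sum.inr u' → 
        ∃ u' v', u = Sum.map Sum.inr Sum.inr u' ∧ v = Sum.map Sum.inr Sum.inr v' ∧
        EdgeRel b u' v' := by
      rintro t' u' rfl hu' rfl
      rw [concatWire_lower, vL, Option.map_eq_some_iff] at hv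
      obtain ⟨v', hv', rfl⟩ := hv
      exact ⟨u', v', rfl, rfl, t', hu', hv'⟩
    rcases t with i | ⟨s | s, i⟩ | (m | m)
    · exact Or.inl (upper (.source i) rfl)
    · exact Or.inl (upper (.ofSplit s i) rfl)
    · exact Or.inr (lower (.ofSplit s i) (.inl s) rfl rfl (Option.some.inj hu).symm)
    · exact Or.inl (upper (.ofMerge m) rfl)
    · exact Or.inr (lower (.ofMerge m) (.inr m) rfl rfl (Option.some.inj hu).symm)
  have injl : Function.Injective (Sum.map Sum.inl Sum.inl : S ⊕ M → (S ⊕ S') ⊕ (M ⊕ M')) :=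
    Sum.map_injective.2 ⟨Sum.inl_injective, Sum.inl_injective⟩
  have injr : Function.Injective (Sum.map Sum.inr Sum.inr : S' ⊕ M' → (S ⊕ S') ⊕ (M ⊕ M')) :=
    Sum.map_injective.2 ⟨Sum.inr_injective, Sum.inr_injective⟩
  have disj : ∀ (x : S ⊕ M) (y : S' ⊕ M'), (Sum.map Sum.inl Sum.inl x : (S ⊕ S') ⊕ (M ⊕ M')) ≠
      Sum.map Sum.inr Sum.inr y := by
    rintro (_ | _) (_ | _) <;> simp
  induction hr with
  | single hr =>
    rcases step hr with ⟨u', rfl, ⟨v', rfl, h'⟩ | ⟨v', rfl⟩⟩ | ⟨u', v', rfl, rfl, h'⟩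
    · exact Or.inl ⟨u', v', rfl, rfl, .single h'⟩
    · exact Or.inr (Or.inl ⟨u', v', rfl, rfl⟩)
    · exact Or.inr (Or.inr ⟨u', v', rfl, rfl, .single h'⟩)
  | tail _ hr ih =>
    rcases step hr with ⟨w', rfl, hw⟩ | ⟨w', v', rfl, rfl, h'⟩
    · rcases ih with ⟨u', w'', rfl, he, h''⟩ | ⟨u', w'', rfl, he⟩ | ⟨u', w'', rfl, he, h''⟩
      · obtain rfl := injl he
        rcases hw with ⟨v', rfl, h'⟩ | ⟨v', rfl⟩
        · exact Or.inl ⟨u', v', rfl, rfl, h''.tail h'⟩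
        · exact Or.inr (Or.inl ⟨u', v', rfl, rfl⟩)
      · exact absurd he (disj _ _)
      · exact absurd he (disj _ _)
    · rcases ih with ⟨u', w'', rfl, he, h''⟩ | ⟨u', w'', rfl, he⟩ | ⟨u', w'', rfl, he, h''⟩
      · exact absurd he.symm (disj _ _)
      · exact Or.inr (Or.inl ⟨u', v', rfl, rfl⟩)
      · obtain rfl := injr he
        exact Or.inr (Or.inr ⟨u', v', rfl, rfl, h''.tail h'⟩)

theorem acyclic_concat {a : Tail n h S M ≃ Head n k S M} {b : Tail n k S' M' ≃ Head n l S' M'}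
    (ha : ∀ v, ¬ Relation.TransGen (EdgeRel a) v v)
    (hb : ∀ v, ¬ Relation.TransGen (EdgeRel b) v v) (v : (S ⊕ S') ⊕ (M ⊕ M')) :
    ¬ Relation.TransGen (EdgeRel (concatWire a b)) v v := by
  intro hv
  rcases transGen_concat hv with ⟨u', v', rfl, he, h'⟩ | ⟨u', v', rfl, he⟩ | ⟨u', v', rfl, he, h'⟩
  · obtain rfl := Sum.map_injective.2 ⟨Sum.inl_injective, Sum.inl_injective⟩ he
    exact ha _ h'
  · rcases u' with _ | _ <;> rcases v' with _ | _ <;> simp at he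
  · obtain rfl := Sum.map_injective.2 ⟨Sum.inr_injective, Sum.inr_injective⟩ he
    exact hb _ h'

end Concat

/-- Concatenation: `A` is placed on top of `B`, and each sink of `A` is glued to the corresponding
source of `B`, so that the two edges that meet there become one edge. -/
def concat (A : StrandDiagram n h k) (B : StrandDiagram n k l) : StrandDiagram n h l where
  Split := A.Split ⊕ B.Split
  Merge := A.Merge ⊕ B.Merge
  finite_split := by
    have := A.finite_split
    have := B.finite_split
    infer_instance
  finite_merge := by
    have := A.finite_merge
    have := B.finite_merge
    infer_instance
  wire := concatWire A.wire B.wire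
  acyclic := acyclic_concat A.acyclic B.acyclic
  plane := plane_concat A.plane B.plane

/-- The concatenation of `p` copies of a diagram. -/
def pow (A : StrandDiagram n k k) : ℕ → StrandDiagram n k k
  | 0 => one n k
  | p + 1 => (A.pow p).concat A

section Congruence

theorem map_reflectTail {S M S' M' : Type} (f : S → S') (g : M → M') (t : Tail n h S M) :
    reflectTail (t.map f g) = (reflectTail t).map g f := by
  rcases t with _ | _ | _ <;> rfl

theorem map_reflectTail_symm {S M S' M' : Type} (f : S → S') (g : M → M') (t : Head n h S M) :
    reflectTail.symm (t.map f g) = (reflectTail.symm t).map g f := by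
  rcases t with _ | _ | _ <;> rfl

theorem map_upperTail {S M S' M' T N : Type} (f : S → S') (g : M → M') (f' : T → T) (g' : N → N)
    (t : Tail n h S M) :
    (upperTail t).map (Sum.map f f') (Sum.map g g') = upperTail (S' := T) (M' := N) (t.map f g) := by
  rcases t with _ | _ | _ <;> rfl

theorem map_inl_upperTail {S M S' M' T N : Type} (f : S → S') (g : M → M') (t : Tail n h T N) :
    (upperTail t).map (Sum.map id f) (Sum.map id g) = upperTail (S' := S') (M' := M') t := by
  rcases t with _ | _ | _ <;> rfl

theorem map_lowerHead {S M S' M' T N : Type} (f : S → S') (g : M → M')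
    (t : Head n h T N) :
    (lowerHead t).map (Sum.map f id) (Sum.map g id) = lowerHead (S := S') (M := M') t := by
  rcases t with _ | _ | _ <;> rfl

theorem map_inr_lowerHead {S M S' M' T N : Type} (f : S → S') (g : M → M')
    (t : Head n h S M) :
    (lowerHead t).map (Sum.map id f) (Sum.map id g) = lowerHead (S := T) (M := N) (t.map f g) := by
  rcases t with _ | _ | _ <;> rfl

theorem map_upperHead {S M S' M' T N : Type} (f : S → S') (g : M → M')
    (c : Tail n k T N ≃ Head n l T N) (t : Head n k S M) :
    (upperHead c t).map (Sum.map f id) (Sum.map g id) = upperHead c (t.map f g) := by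
  rcases t with _ | _ | _
  · exact map_lowerHead _ _ _
  · rfl
  · rfl

theorem map_lowerTail {S M S' M' T N : Type} (f : S → S') (g : M → M')
    (c : Tail n h T N ≃ Head n k T N) (t : Tail n k S M) :
    (lowerTail c t).map (Sum.map id f) (Sum.map id g) = lowerTail c (t.map f g) := by
  rcases t with _ | _ | _
  · exact map_inl_upperTail _ _ _
  · rfl
  · rfl

theorem upper_cases {S M S' M' : Type} (a : Tail n h S M ≃ Head n k S M)
    (t : Tail n h (S ⊕ S') (M ⊕ M')) : (∃ t', t = upperTail t') ∨
      (∃ s i, t = lowerTail a (.ofSplit s i)) ∨ (∃ m, t = lowerTail a (.ofMerge m)) := by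
  rcases t with i | ⟨s | s, i⟩ | (m | m)
  · exact Or.inl ⟨.source i, rfl⟩
  · exact Or.inl ⟨.ofSplit s i, rfl⟩
  · exact Or.inr (Or.inl ⟨s, i, rfl⟩)
  · exact Or.inl ⟨.ofMerge m, rfl⟩
  · exact Or.inr (Or.inr ⟨m, rfl⟩)

theorem lower_cases {S M S' M' : Type} (a : Tail n h S M ≃ Head n k S M)
    (t : Tail n h (S ⊕ S') (M ⊕ M')) : (∃ t', t = lowerTail a t') ∨
      (∃ t' s, t = upperTail t' ∧ a t' = .toSplit s) ∨
      (∃ t' m i, t = upperTail t' ∧ a t' = .toMerge m i) := by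
  rcases upper_cases a t with ⟨t', rfl⟩ | ⟨s, i, rfl⟩ | ⟨m, rfl⟩
  · rcases ha : a t' with j | s | ⟨m, i⟩
    · exact Or.inl ⟨.source j, by simp [lowerTail, ← ha]⟩
    · exact Or.inr (Or.inl ⟨t', s, rfl, ha⟩)
    · exact Or.inr (Or.inr ⟨t', m, i, rfl, ha⟩)
  · exact Or.inl ⟨_, rfl⟩
  · exact Or.inl ⟨_, rfl⟩

theorem deletes_inl {X Y Z : Type} {f : X → Y} {y : Y} (hf : Deletes f y) :
    Deletes (Sum.map f (id : Z → Z)) (Sum.inl y) := by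
  refine ⟨Sum.map_injective.2 ⟨hf.1, Function.injective_id⟩, ?_⟩
  rintro (x | x)
  · simpa using hf.2 x
  · simp

theorem deletes_inr {X Y Z : Type} {f : X → Y} {y : Y} (hf : Deletes f y) :
    Deletes (Sum.map (id : Z → Z) f) (Sum.inr y) := by
  refine ⟨Sum.map_injective.2 ⟨Function.injective_id, hf.1⟩, ?_⟩
  rintro (x | x)
  · simp
  · simpa using hf.2 x

theorem reflectWire_apply {S M : Type} (w : Tail n h S M ≃ Head n k S M) (t : Tail n h S M) :
    reflectWire w (reflectTail.symm (w t)) = reflectTail t := by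
  simp [reflectWire]

theorem step_reflect {A B : StrandDiagram n h k} (hs : Step A B) : Step A.reflect B.reflect := by
  have surj : ∀ t, ∃ t', t = reflectTail.symm (B.wire t') := fun t =>
    ⟨B.wire.symm (reflectTail t), by simp⟩
  have surjA : ∀ t, ∃ t', t = reflectTail.symm (A.wire t') := fun t =>
    ⟨A.wire.symm (reflectTail t), by simp⟩
  rcases hs with ⟨σ, μ, hw⟩ | ⟨s, m, σ, μ, hc, hσ, hμ, hw⟩ | ⟨s, m, σ, μ, hc, hσ, hμ, hw⟩
  · refine Or.inl ⟨μ, σ, fun t => ?_⟩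
    obtain ⟨t', rfl⟩ := surjA t
    change reflectWire B.wire (Tail.map (S' := B.Merge) (M' := B.Split) μ σ _) =
      Head.map (S' := B.Merge) (M' := B.Split) μ σ (reflectWire A.wire _)
    rw [← map_reflectTail_symm, ← hw, reflectWire_apply, reflectWire_apply, map_reflectTail]
  · refine Or.inr (Or.inl ⟨m, s, μ, σ, fun i => ?_, hμ, hσ, fun t => ?_⟩)
    · change reflectWire A.wire (reflectTail.symm (Head.toMerge m i)) = _
      rw [← hc i, reflectWire_apply]; rfl
    · obtain ⟨t', rfl⟩ := surj t
      change reflectWire A.wire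
          (Tail.map (S := B.Merge) (M := B.Split) (S' := A.Merge) (M' := A.Split) μ σ _) =
        Head.map (S := B.Merge) (M := B.Split) (S' := A.Merge) (M' := A.Split) μ σ
          (reflectWire B.wire _) ∨
        (reflectWire A.wire
          (Tail.map (S := B.Merge) (M := B.Split) (S' := A.Merge) (M' := A.Split) μ σ _) = _ ∧
        reflectWire A.wire (reflectTail.symm (Head.toSplit s)) =
        Head.map (S := B.Merge) (M := B.Split) (S' := A.Merge) (M' := A.Split) μ σ
          (reflectWire B.wire _))
      rw [← map_reflectTail_symm, reflectWire_apply, ← map_reflectTail]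
      rcases hw t' with h₁ | ⟨h₁, h₂⟩
      · left; rw [← h₁, reflectWire_apply]
      · right
        rw [← h₁, ← h₂, reflectWire_apply, reflectWire_apply]
        exact ⟨rfl, rfl⟩
  · refine Or.inr (Or.inr ⟨m, s, μ, σ, ?_, hμ, hσ, fun t => ?_⟩)
    · change reflectWire A.wire (reflectTail.symm (Head.toSplit s)) = _
      rw [← hc, reflectWire_apply]; rfl
    · obtain ⟨t', rfl⟩ := surj t
      change reflectWire A.wire
          (Tail.map (S := B.Merge) (M := B.Split) (S' := A.Merge) (M' := A.Split) μ σ _) =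
        Head.map (S := B.Merge) (M := B.Split) (S' := A.Merge) (M' := A.Split) μ σ
          (reflectWire B.wire _) ∨
        ∃ i, reflectWire A.wire
          (Tail.map (S := B.Merge) (M := B.Split) (S' := A.Merge) (M' := A.Split) μ σ _) = _ ∧
        reflectWire A.wire (reflectTail.symm (Head.toMerge m i)) =
        Head.map (S := B.Merge) (M := B.Split) (S' := A.Merge) (M' := A.Split) μ σ
          (reflectWire B.wire _)
      rw [← map_reflectTail_symm, reflectWire_apply, ← map_reflectTail]
      rcases hw t' with h₁ | ⟨i, h₁, h₂⟩
      · left; rw [← h₁, reflectWire_apply]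
      · right
        refine ⟨i, ?_⟩
        rw [← h₁, ← h₂, reflectWire_apply, reflectWire_apply]
        exact ⟨rfl, rfl⟩

theorem step_concat_left {A B : StrandDiagram n h k} (C : StrandDiagram n k l) (hs : Step A B) :
    Step (A.concat C) (B.concat C) := by
  rcases hs with ⟨σ, μ, hw⟩ | ⟨s, m, σ, μ, hc, hσ, hμ, hw⟩ | ⟨s, m, σ, μ, hc, hσ, hμ, hw⟩
  · refine Or.inl ⟨σ.sumCongr (Equiv.refl _), μ.sumCongr (Equiv.refl _), fun t => ?_⟩
    change concatWire B.wire C.wire (t.map (Sum.map σ id) (Sum.map μ id)) =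
      (concatWire A.wire C.wire t).map (Sum.map σ id) (Sum.map μ id)
    rcases upper_cases A.wire t with ⟨t', rfl⟩ | ⟨s, i, rfl⟩ | ⟨m, rfl⟩
    · rw [map_upperTail, concatWire_upper, concatWire_upper, hw, map_upperHead]
    · rw [concatWire_lower, map_lowerHead]; rfl
    · rw [concatWire_lower, map_lowerHead]; rfl
  · refine Or.inr (Or.inl ⟨.inl s, .inl m, Sum.map σ id, Sum.map μ id, ?_, deletes_inl hσ,
      deletes_inl hμ, fun t => ?_⟩)
    · intro i
      change upperHead C.wire (A.wire (.ofSplit s i)) = _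
      rw [hc i]; rfl
    · change concatWire A.wire C.wire (t.map (Sum.map σ id) (Sum.map μ id)) =
        (concatWire B.wire C.wire t).map (Sum.map σ id) (Sum.map μ id) ∨
        (concatWire A.wire C.wire (t.map (Sum.map σ id) (Sum.map μ id)) = .toSplit (.inl s) ∧
          upperHead C.wire (A.wire (.ofMerge m)) =
            (concatWire B.wire C.wire t).map (Sum.map σ id) (Sum.map μ id))
      rcases upper_cases B.wire t with ⟨t', rfl⟩ | ⟨s, i, rfl⟩ | ⟨m, rfl⟩
      · rw [map_upperTail, concatWire_upper, concatWire_upper, map_upperHead]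
        rcases hw t' with h₁ | ⟨h₁, h₂⟩
        · rw [h₁]; exact Or.inl rfl
        · rw [h₁, h₂]; exact Or.inr ⟨rfl, rfl⟩
      · left; rw [concatWire_lower, map_lowerHead]; rfl
      · left; rw [concatWire_lower, map_lowerHead]; rfl
  · refine Or.inr (Or.inr ⟨.inl s, .inl m, Sum.map σ id, Sum.map μ id, ?_, deletes_inl hσ,
      deletes_inl hμ, fun t => ?_⟩)
    · change upperHead C.wire (A.wire (.ofMerge m)) = _
      rw [hc]; rfl
    · change concatWire A.wire C.wire (t.map (Sum.map σ id) (Sum.map μ id)) =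
        (concatWire B.wire C.wire t).map (Sum.map σ id) (Sum.map μ id) ∨
        ∃ i, concatWire A.wire C.wire (t.map (Sum.map σ id) (Sum.map μ id)) =
            .toMerge (.inl m) i ∧
          upperHead C.wire (A.wire (.ofSplit s i)) =
            (concatWire B.wire C.wire t).map (Sum.map σ id) (Sum.map μ id)
      rcases upper_cases B.wire t with ⟨t', rfl⟩ | ⟨s, i, rfl⟩ | ⟨m, rfl⟩
      · rw [map_upperTail, concatWire_upper, concatWire_upper, map_upperHead]
        rcases hw t' with h₁ | ⟨i, h₁, h₂⟩
        · rw [h₁]; exact Or.inl rfl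
        · rw [h₁]; exact Or.inr ⟨i, rfl, by rw [h₂]⟩
      · left; rw [concatWire_lower, map_lowerHead]; rfl
      · left; rw [concatWire_lower, map_lowerHead]; rfl

theorem step_concat_right {A B : StrandDiagram n k l} (C : StrandDiagram n h k) (hs : Step A B) :
    Step (C.concat A) (C.concat B) := by
  rcases hs with ⟨σ, μ, hw⟩ | ⟨s, m, σ, μ, hc, hσ, hμ, hw⟩ | ⟨s, m, σ, μ, hc, hσ, hμ, hw⟩
  · refine Or.inl ⟨(Equiv.refl _).sumCongr σ, (Equiv.refl _).sumCongr μ, fun t => ?_⟩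
    change concatWire C.wire B.wire (t.map (Sum.map id σ) (Sum.map id μ)) =
      (concatWire C.wire A.wire t).map (Sum.map id σ) (Sum.map id μ)
    rcases lower_cases C.wire t with ⟨t', rfl⟩ | ⟨t', s, rfl, ht⟩ | ⟨t', m, i, rfl, ht⟩
    · rw [map_lowerTail, concatWire_lower, concatWire_lower, hw, map_inr_lowerHead]
    · rw [map_inl_upperTail, concatWire_upper, concatWire_upper, ht]; rfl
    · rw [map_inl_upperTail, concatWire_upper, concatWire_upper, ht]; rfl
  · refine Or.inr (Or.inl ⟨.inr s, .inr m, Sum.map id σ, Sum.map id μ, ?_, deletes_inr hσ,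
      deletes_inr hμ, fun t => ?_⟩)
    · intro i
      change lowerHead (A.wire (.ofSplit s i)) = _
      rw [hc i]; rfl
    · change concatWire C.wire A.wire (t.map (Sum.map id σ) (Sum.map id μ)) =
        (concatWire C.wire B.wire t).map (Sum.map id σ) (Sum.map id μ) ∨
        (concatWire C.wire A.wire (t.map (Sum.map id σ) (Sum.map id μ)) = .toSplit (.inr s) ∧
          lowerHead (A.wire (.ofMerge m)) =
            (concatWire C.wire B.wire t).map (Sum.map id σ) (Sum.map id μ))
      rcases lower_cases C.wire t with ⟨t', rfl⟩ | ⟨t', s, rfl, ht⟩ | ⟨t', m, i, rfl, ht⟩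
      · rw [map_lowerTail, concatWire_lower, concatWire_lower, map_inr_lowerHead]
        rcases hw t' with h₁ | ⟨h₁, h₂⟩
        · rw [h₁]; exact Or.inl rfl
        · rw [h₁, h₂]; exact Or.inr ⟨rfl, rfl⟩
      · left; rw [map_inl_upperTail, concatWire_upper, concatWire_upper, ht]; rfl
      · left; rw [map_inl_upperTail, concatWire_upper, concatWire_upper, ht]; rfl
  · refine Or.inr (Or.inr ⟨.inr s, .inr m, Sum.map id σ, Sum.map id μ, ?_, deletes_inr hσ,
      deletes_inr hμ, fun t => ?_⟩)
    · change lowerHead (A.wire (.ofMerge m)) = _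
      rw [hc]; rfl
    · change concatWire C.wire A.wire (t.map (Sum.map id σ) (Sum.map id μ)) =
        (concatWire C.wire B.wire t).map (Sum.map id σ) (Sum.map id μ) ∨
        ∃ i, concatWire C.wire A.wire (t.map (Sum.map id σ) (Sum.map id μ)) =
            .toMerge (.inr m) i ∧
          lowerHead (A.wire (.ofSplit s i)) =
            (concatWire C.wire B.wire t).map (Sum.map id σ) (Sum.map id μ)
      rcases lower_cases C.wire t with ⟨t', rfl⟩ | ⟨t', s, rfl, ht⟩ | ⟨t', m, i, rfl, ht⟩
      · rw [map_lowerTail, concatWire_lower, concatWire_lower, map_inr_lowerHead]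
        rcases hw t' with h₁ | ⟨i, h₁, h₂⟩
        · rw [h₁]; exact Or.inl rfl
        · rw [h₁]; exact Or.inr ⟨i, rfl, by rw [h₂]⟩
      · left; rw [map_inl_upperTail, concatWire_upper, concatWire_upper, ht]; rfl
      · left; rw [map_inl_upperTail, concatWire_upper, concatWire_upper, ht]; rfl

end Congruence

theorem lift_step {h' k' : ℕ} {f : StrandDiagram n h k → StrandDiagram n h' k'}
    (hf : ∀ A B, Step A B → Step (f A) (f B)) {A B : StrandDiagram n h k}
    (hAB : (equivalence n h k) A B) : (equivalence n h' k') (f A) (f B) := by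
  induction hAB with
  | rel A B hr => exact Relation.EqvGen.rel _ _ (hf A B hr)
  | refl A => exact Relation.EqvGen.refl _
  | symm A B _ ih => exact Relation.EqvGen.symm _ _ ih
  | trans A B C _ _ ih₁ ih₂ => exact Relation.EqvGen.trans _ _ _ ih₁ ih₂

end StrandDiagram

/-- The morphisms from `h` to `k` in the groupoid of strand diagrams: equivalence classes of
`(h, k)`-strand diagrams. -/
def StrandClass (n h k : ℕ) : Type 1 := Quotient (StrandDiagram.equivalence n h k)

namespace StrandClass

variable {n h k l : ℕ}

/-- The class `[A]` of a strand diagram. -/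
def mk (A : StrandDiagram n h k) : StrandClass n h k := Quotient.mk _ A

/-- Composition in the groupoid of strand diagrams: `[A][B]` is the class of the
concatenation with `A` on top of `B`. -/
def comp (f : StrandClass n h k) (g : StrandClass n k l) : StrandClass n h l :=
  Quotient.map₂ StrandDiagram.concat
    (fun _ B hA C _ hC => (StrandDiagram.equivalence n h l).trans
      (StrandDiagram.lift_step (fun _ _ => StrandDiagram.step_concat_left C) hA)
      (StrandDiagram.lift_step (fun _ _ => StrandDiagram.step_concat_right B) hC))
    f g

/-- Inversion in the groupoid of strand diagrams: the class of the mirror image. -/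
def inv (f : StrandClass n h k) : StrandClass n k h :=
  Quotient.map StrandDiagram.reflect
    (fun _ _ hA => StrandDiagram.lift_step (fun _ _ => StrandDiagram.step_reflect) hA) f

end StrandClass

/-- The (underlying set of the) Brown-Thompson group `F_n`, as the isotropy group at the object `1`
of the groupoid of strand diagrams: its elements are the equivalence classes of all
`(1, 1)`-strand diagrams, with product `StrandClass.comp` and inverse `StrandClass.inv`. -/
def BrownThompson (n : ℕ) : Type 1 := StrandClass n 1 1

/-! Among all ways of writing `g` as `[S][E][S]⁻¹`, take one in which `E` has as few vertices as
possible. Then every power of `E` is reduced, by induction on the exponent, for all minimal `E` at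
once (`pow_reduced_of_minimal`).

Suppose `E^p` is reduced for every minimal `E`, but `E^(p+1) = E^p E` has a redex: vertices `v`, `w`
such that the edges out of `v` are exactly the edges into `w`, in order. Both cannot lie in `E^p`,
and `w` cannot lie above `v`. Both cannot lie in the last `E`, since a diagram that is not reduced
is equivalent to a smaller one (`exists_size_lt`). So `v` lies in `E^p` and `w` in the last `E`, and
all edges into `w` come from sources of `E`. Hence `w` can be peeled off the top
(`exists_isotopic_concat`): `E = XY`, where `X` has `w` as its only vertex and `[X][X]⁻¹ = 1`. Now
`YX` is again minimal, being conjugate to `E` by `X` and of the same size. The redex is already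
visible in `E^p X = (XY)^p X = X (YX)^p`, where all identifications are isotopies. Its lower vertex
has the kind (split or merge) of `w`, so its upper vertex has the other kind and is not in `X`. The
redex therefore lies inside `(YX)^p`, which contradicts the induction hypothesis for `YX`.

Planarity enters in cutting diagrams. A sweep can be reordered by exchanging consecutive vertices
that share no edge, and cutting it at a position of the line factors the diagram
(`exists_realizes`). All new diagrams are concatenations of one-vertex diagrams, so they are plane
and acyclic by construction. -/

/-! ### Vertices as rewriting rules on the sweeping line, and reordering of sweeps -/

/-- Blocks without common entries cannot overlap, so one of them ends before the other begins. Both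
must be nonempty: an empty block could sit inside the other one. -/
theorem List.append_append_eq_of_disjoint {α : Type*} {A O B A' I B' : List α} (hO : O ≠ [])
    (hI : I ≠ []) (hd : O.Disjoint I) (he : A ++ O ++ B = A' ++ I ++ B') :
    (∃ C, A' = A ++ O ++ C ∧ B = C ++ I ++ B') ∨ (∃ C, A = A' ++ I ++ C ∧ B' = C ++ O ++ B) := by
  have aux : ∀ {P Q X Y C : List α}, P ≠ [] → Q ≠ [] → P.Disjoint Q →
      P ++ X = C ++ (Q ++ Y) → ∃ D, C = P ++ D ∧ X = D ++ (Q ++ Y) := by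
    intro P Q X Y C hP hQ hPQ h
    rcases List.append_eq_append_iff.1 h with ⟨D, h₁, h₂⟩ | ⟨D, h₁, h₂⟩
    · exact ⟨D, h₁, h₂⟩
    · rcases D with _ | ⟨d, D⟩
      · exact ⟨[], by simpa using h₁.symm, by simpa using h₂.symm⟩
      · rcases Q with _ | ⟨q, Q⟩
        · exact absurd rfl hQ
        · simp only [List.cons_append, List.cons.injEq] at h₂
          exact (hPQ (a := d) (by simp [h₁]) (by simp [h₂.1])).elim
  rw [List.append_assoc, List.append_assoc] at he
  rcases List.append_eq_append_iff.1 he with ⟨C, h₁, h₂⟩ | ⟨C, h₁, h₂⟩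
  · obtain ⟨D, rfl, rfl⟩ := aux hO hI hd h₂
    exact Or.inl ⟨D, by simp [h₁], by simp⟩
  · obtain ⟨D, rfl, rfl⟩ := aux hI hO hd.symm h₂
    exact Or.inr ⟨D, by simp [h₁], by simp⟩

section Ports

variable {n h k : ℕ} {S M : Type}

/-- The edges that enter a vertex, from left to right. -/
def ins (wire : Tail n h S M ≃ Head n k S M) : S ⊕ M → List (Tail n h S M)
  | .inl s => [wire.symm (.toSplit s)]
  | .inr m => List.ofFn fun i => wire.symm (.toMerge m i)

/-- The edges that leave a vertex, from left to right. -/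
def outs : S ⊕ M → List (Tail n h S M)
  | .inl s => List.ofFn fun i => .ofSplit s i
  | .inr m => [.ofMerge m]

variable {wire : Tail n h S M ≃ Head n k S M}

theorem ins_ne_nil (hn : n ≠ 0) (v : S ⊕ M) : ins wire v ≠ [] := by
  rcases v with s | m <;> simp [ins, hn]

theorem outs_ne_nil (hn : n ≠ 0) (v : S ⊕ M) : outs (h := h) (n := n) v ≠ [] := by
  rcases v with s | m <;> simp [outs, hn]

theorem mem_outs {v : S ⊕ M} {t : Tail n h S M} : t ∈ outs v ↔ t.vertex? = some v := by
  rcases v with s | m <;> rcases t with i | ⟨s', i⟩ | m' <;>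
    simp [outs, Tail.vertex?, List.mem_ofFn, eq_comm]

theorem mem_ins {v : S ⊕ M} {t : Tail n h S M} :
    t ∈ ins wire v ↔ (wire t).vertex? = some v := by
  obtain ⟨x, rfl⟩ := wire.symm.surjective t
  rcases v with s | m <;> rcases x with i | s' | ⟨m', i⟩ <;>
    simp [ins, Head.vertex?, List.mem_ofFn, eq_comm]

theorem outs_nodup (v : S ⊕ M) : (outs (n := n) (h := h) v).Nodup := by
  rcases v with s | m
  · exact List.nodup_ofFn.2 fun i j hij => by simpa using hij
  · simp [outs]

theorem outs_disjoint {v w : S ⊕ M} (hvw : v ≠ w) :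
    (outs (n := n) (h := h) v).Disjoint (outs w) := by
  intro t ht ht'
  rw [mem_outs] at ht ht'
  exact hvw (Option.some.inj (ht.symm.trans ht'))

namespace Sweep

/-- Together with `of_cons`, this merges the two constructors into one rule, `ins` replaced by
`outs`, so that arguments about sweeps need not separate splits from merges. -/
theorem cons {v : S ⊕ M} {vs : List (S ⊕ M)} {L R L' : List (Tail n h S M)}
    (hs : Sweep wire vs (L ++ outs v ++ R) L') : Sweep wire (v :: vs) (L ++ ins wire v ++ R) L' := by
  rcases v with s | m
  · exact .split s vs L R L' hs
  · exact .merge m vs L R L' hs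

theorem of_cons {v : S ⊕ M} {vs : List (S ⊕ M)} {K L' : List (Tail n h S M)}
    (hs : Sweep wire (v :: vs) K L') :
    ∃ L R, K = L ++ ins wire v ++ R ∧ Sweep wire vs (L ++ outs v ++ R) L' := by
  cases hs with
  | split s _ L R _ hs => exact ⟨L, R, rfl, hs⟩
  | merge m _ L R _ hm => exact ⟨L, R, rfl, hm⟩

theorem of_nil {K L' : List (Tail n h S M)} (hs : Sweep wire [] K L') : K = L' := by
  cases hs; rfl

theorem of_append {vs ws : List (S ⊕ M)} {K L' : List (Tail n h S M)}
    (hs : Sweep wire (vs ++ ws) K L') : ∃ K', Sweep wire vs K K' ∧ Sweep wire ws K' L' := by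
  induction vs generalizing K with
  | nil => exact ⟨K, .nil _, hs⟩
  | cons v vs ih =>
    obtain ⟨L, R, rfl, hs'⟩ := of_cons hs
    obtain ⟨K', h₁, h₂⟩ := ih hs'
    exact ⟨K', cons h₁, h₂⟩

/-- If no edge leads from `v` to `w`, then `w` consumes a block that was already on the line beside
the one consumed by `v`, so the two moves commute. -/
theorem swap (hn : n ≠ 0) {v w : S ⊕ M} {vs : List (S ⊕ M)} {K L' : List (Tail n h S M)}
    (hd : (outs v).Disjoint (ins wire w)) (hs : Sweep wire (v :: w :: vs) K L') :
    Sweep wire (w :: v :: vs) K L' := by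
  obtain ⟨L, R, rfl, hs'⟩ := of_cons hs
  obtain ⟨A, B, he, hs''⟩ := of_cons hs'
  rcases List.append_append_eq_of_disjoint (outs_ne_nil hn v) (ins_ne_nil hn w) hd he with
    ⟨C, rfl, rfl⟩ | ⟨C, rfl, rfl⟩
  · have h₁ : Sweep wire vs (L ++ outs v ++ (C ++ outs w ++ B)) L' := by simpa using hs''
    have h₂ : Sweep wire (v :: vs) ((L ++ ins wire v ++ C) ++ outs w ++ B) L' := by
      simpa using cons h₁
    simpa using cons h₂
  · have h₁ : Sweep wire vs ((A ++ outs w ++ C) ++ outs v ++ R) L' := by simpa using hs''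
    have h₂ : Sweep wire (v :: vs) (A ++ outs w ++ (C ++ ins wire v ++ R)) L' := by
      simpa using cons h₁
    simpa using cons h₂

theorem move_down (hn : n ≠ 0) {v : S ⊕ M} {vs : List (S ⊕ M)} {K L' : List (Tail n h S M)}
    (hd : ∀ w ∈ vs, (outs v).Disjoint (ins wire w)) (hs : Sweep wire (v :: vs) K L') :
    Sweep wire (vs ++ [v]) K L' := by
  induction vs generalizing K with
  | nil => exact hs
  | cons w vs ih =>
    obtain ⟨L, R, rfl, hs'⟩ := of_cons (swap hn (hd w (by simp)) hs)
    exact cons (ih (fun x hx => hd x (by simp [hx])) hs')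

theorem move_up (hn : n ≠ 0) {v : S ⊕ M} {vs : List (S ⊕ M)} {K L' : List (Tail n h S M)}
    (hd : ∀ w ∈ vs, (outs w).Disjoint (ins wire v)) (hs : Sweep wire (vs ++ [v]) K L') :
    Sweep wire (v :: vs) K L' := by
  induction vs generalizing K with
  | nil => exact hs
  | cons w vs ih =>
    obtain ⟨L, R, rfl, hs'⟩ := of_cons hs
    exact swap hn (hd w (by simp)) (cons (ih (fun x hx => hd x (by simp [hx])) hs'))

theorem mem_line {vs : List (S ⊕ M)} {K L' : List (Tail n h S M)} (hs : Sweep wire vs K L')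
    {t : Tail n h S M} (ht : t ∈ L') : t ∈ K ∨ ∃ v ∈ vs, t ∈ outs v := by
  induction vs generalizing K with
  | nil => obtain rfl := of_nil hs; exact Or.inl ht
  | cons v vs ih =>
    obtain ⟨L, R, rfl, hs'⟩ := of_cons hs
    rcases ih hs' with h' | ⟨w, hw, h'⟩
    · simp only [List.mem_append] at h' ⊢
      rcases h' with (h' | h') | h'
      · exact Or.inl (Or.inl (Or.inl h'))
      · exact Or.inr ⟨v, by simp, h'⟩
      · exact Or.inl (Or.inr h')
    · exact Or.inr ⟨w, by simp [hw], h'⟩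

/-- Every vertex puts fresh edges on the line. Without repetitions on the line, a nonempty block can
occur at one place only, which is how `Sweep.exists_adjacent` uses this. -/
theorem nodup_line {vs : List (S ⊕ M)} {K L' : List (Tail n h S M)} (hs : Sweep wire vs K L')
    (hvs : vs.Nodup) (hK : K.Nodup) (hd : ∀ v ∈ vs, K.Disjoint (outs v)) : L'.Nodup := by
  induction vs generalizing K with
  | nil => obtain rfl := of_nil hs; exact hK
  | cons v vs ih =>
    obtain ⟨L, R, rfl, hs'⟩ := of_cons hs
    obtain ⟨hv, hvs⟩ := List.nodup_cons.1 hvs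
    have hdv := hd v (by simp)
    simp only [List.nodup_append', List.disjoint_append_left]
      at hK hd hdv
    refine ih hs' hvs ?_ fun w hw => ?_
    · simp only [List.nodup_append', List.disjoint_append_left]
      exact ⟨⟨hK.1.1, outs_nodup v, hdv.1.1⟩, hK.2.1, hK.2.2.1, hdv.2.symm⟩
    · simp only [List.disjoint_append_left]
      have := hd w (by simp [hw])
      exact ⟨⟨this.1.1, outs_disjoint (by rintro rfl; exact hv hw)⟩, this.2⟩

end Sweep

theorem source_not_mem_outs (i : Fin h) (v : S ⊕ M) : Tail.source (n := n) i ∉ outs v := by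
  simp [mem_outs, Tail.vertex?]

/-- A vertex all of whose incoming edges start at sources can be passed first. -/
theorem Sweep.exists_cons (hn : n ≠ 0) {vs : List (S ⊕ M)} {K L' : List (Tail n h S M)}
    (hs : Sweep wire vs K L') (hvs : vs.Nodup) {w : S ⊕ M} (hw : w ∈ vs)
    (hd : ∀ v, (outs v).Disjoint (ins wire w)) :
    ∃ ws, (w :: ws).Nodup ∧ (∀ v, v ∈ vs ↔ v ∈ w :: ws) ∧ Sweep wire (w :: ws) K L' := by
  obtain ⟨a, b, rfl⟩ := List.append_of_mem hw
  refine ⟨a ++ b, ?_, by simp [or_left_comm], ?_⟩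
  · exact (List.perm_middle.nodup_iff).1 hvs
  · rw [List.append_cons] at hs
    obtain ⟨K', h₁, h₂⟩ := Sweep.of_append hs
    exact StrandDiagram.sweep_trans (Sweep.move_up hn (fun v _ => hd v) h₁) h₂

/-- If the edges out of `v` are the edges into `w`, then `w` can be passed just after `v`. -/
theorem Sweep.exists_adjacent (hn : n ≠ 0) {vs : List (S ⊕ M)} {L' : List (Tail n h S M)}
    (hs : Sweep wire vs (List.ofFn fun i => Tail.source i) L') (hvs : vs.Nodup)
    (hall : ∀ v, v ∈ vs) {v w : S ⊕ M} (hvw : outs v = ins wire w) :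
    ∃ a c, (a ++ v :: w :: c).Nodup ∧ (∀ x, x ∈ a ++ v :: w :: c) ∧ ∃ L R,
      Sweep wire a (List.ofFn fun i => Tail.source i) (L ++ ins wire v ++ R) ∧
      Sweep wire c (L ++ outs w ++ R) L' := by
  obtain ⟨a, c, rfl⟩ := List.append_of_mem (hall w)
  -- Just before `w` is passed, an edge out of `v` is on the line. It is not a source edge, so an
  -- earlier vertex emitted it, and that vertex is `v`.
  have hva : v ∈ a := by
    obtain ⟨K', h₁, h₂⟩ := Sweep.of_append hs
    obtain ⟨L, R, rfl, -⟩ := Sweep.of_cons h₂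
    obtain ⟨t, ht⟩ := List.exists_mem_of_ne_nil _ (outs_ne_nil (n := n) (h := h) hn v)
    have ht' : t ∈ L ++ ins wire w ++ R := by simp [← hvw, ht]
    rcases Sweep.mem_line h₁ ht' with h' | ⟨u, hu, h'⟩
    · obtain ⟨i, rfl⟩ := List.mem_ofFn.1 h'
      exact (source_not_mem_outs _ _ ht).elim
    · rw [mem_outs] at h' ht
      rwa [Option.some.inj (ht.symm.trans h')]
  obtain ⟨a, b, rfl⟩ := List.append_of_mem hva
  have hperm : (a ++ v :: b ++ w :: c).Perm (a ++ b ++ v :: w :: c) := by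
    simp only [List.append_assoc, List.cons_append]
    exact List.Perm.append_left _ List.perm_middle.symm
  refine ⟨a ++ b, c, hperm.nodup_iff.1 hvs, fun x => hperm.mem_iff.1 (hall x), ?_⟩
  have hvs' := hperm.nodup_iff.1 hvs
  obtain ⟨K', h₁, h₂⟩ := Sweep.of_append hs
  obtain ⟨K, h₀, h₁⟩ := Sweep.of_append h₁
  have hwb : w ∉ b := by
    intro hwb
    rw [List.nodup_append'] at hvs
    exact hvs.2.2 (by simp [hwb] : w ∈ _) (by simp)
  -- The edges out of `v` enter only `w`, which is not in `b`, so `v` can sink below all of `b`.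
  have h₁ := Sweep.move_down hn (fun x hx t ht ht' => by
    rw [hvw] at ht
    rw [mem_ins] at ht ht'
    obtain rfl := Option.some.inj (ht.symm.trans ht')
    exact hwb hx) h₁
  obtain ⟨K₂, h₅, h₃⟩ := Sweep.of_append h₁
  obtain ⟨L, R, rfl, h₄⟩ := Sweep.of_cons h₃
  obtain rfl := Sweep.of_nil h₄
  obtain ⟨L₂, R₂, he, h₂⟩ := Sweep.of_cons h₂
  have hab := StrandDiagram.sweep_trans h₀ h₅
  have hnd : (L ++ outs v ++ R).Nodup := by
    refine Sweep.nodup_line (StrandDiagram.sweep_trans hab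
      (Sweep.cons (Sweep.nil (wire := wire) (L ++ outs v ++ R)))) ?_ ?_ ?_
    · rw [List.append_cons, List.nodup_append'] at hvs'
      exact hvs'.1
    · exact List.nodup_ofFn.2 fun i j hij => by simpa using hij
    · intro u _ t ht
      obtain ⟨i, rfl⟩ := List.mem_ofFn.1 ht
      exact source_not_mem_outs _ _
  rw [← hvw] at he
  -- The block emitted by `v` and the block consumed by `w` are the same list inside a line without
  -- repetitions, so they also have the same position.
  have hLR : L = L₂ ∧ R = R₂ := by
    obtain ⟨t, O, hO⟩ := List.exists_cons_of_ne_nil (outs_ne_nil (n := n) (h := h) hn v)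
    rw [hO] at he hnd
    have hnd₂ := he ▸ hnd
    simp only [List.append_assoc, List.cons_append] at he hnd hnd₂
    have h₆ : t ∉ L := fun h' => (List.nodup_append'.1 hnd).2.2 h' (by simp)
    have h₇ : t ∉ L₂ := fun h' => (List.nodup_append'.1 hnd₂).2.2 h' (by simp)
    have hl : L = L₂ := by
      rcases List.append_eq_append_iff.1 he with ⟨_ | ⟨d, D⟩, e₁, e₂⟩ | ⟨_ | ⟨d, D⟩, e₁, e₂⟩
      · simpa using e₁.symm
      · exact (h₇ (by simp_all)).elim
      · simpa using e₁
      · exact (h₆ (by simp_all)).elim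
    subst hl
    exact ⟨rfl, by simpa using he⟩
  obtain ⟨rfl, rfl⟩ := hLR
  exact ⟨L, R, hab, h₂⟩

end Ports

/-! ### Wirings that are part of a larger wiring -/

section Embedding

variable {n h k a b : ℕ} {S M S' M' : Type}

/-- Renaming the vertices, and replacing the sources by edges. -/
def tailMap (f : Fin a → Tail n h S M) (σ : S' → S) (μ : M' → M) :
    Tail n a S' M' → Tail n h S M
  | .source i => f i
  | .ofSplit s i => .ofSplit (σ s) i
  | .ofMerge m => .ofMerge (μ m)

/-- Renaming the vertices, and replacing the sinks by heads. -/
def headMap (f : Fin b → Head n k S M) (σ : S' → S) (μ : M' → M) :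
    Head n b S' M' → Head n k S M
  | .sink i => f i
  | .toSplit s => .toSplit (σ s)
  | .toMerge m i => .toMerge (μ m) i

theorem tailMap_source (σ : S' → S) (μ : M' → M) :
    tailMap (n := n) (h := h) Tail.source σ μ = Tail.map σ μ := by
  funext t
  rcases t with _ | _ | _ <;> rfl

theorem headMap_sink (σ : S' → S) (μ : M' → M) :
    headMap (n := n) (k := k) Head.sink σ μ = Head.map σ μ := by
  funext t
  rcases t with _ | _ | _ <;> rfl

/-- The wiring `w` is a part of the wiring `wire`. -/
def Embeds (wire : Tail n h S M ≃ Head n k S M) (w : Tail n a S' M' ≃ Head n b S' M')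
    (f : Fin a → Tail n h S M) (f' : Fin b → Head n k S M) (σ : S' → S) (μ : M' → M) : Prop :=
  ∀ t, wire (tailMap f σ μ t) = headMap f' σ μ (w t)

theorem outs_map (f : Fin a → Tail n h S M) (σ : S' → S) (μ : M' → M) (v : S' ⊕ M') :
    outs (Sum.map σ μ v) = (outs v).map (tailMap f σ μ) := by
  rcases v with s | m <;> simp [outs, tailMap, List.map_ofFn, Function.comp_def]

/-- Each incoming port receives exactly one edge, so an embedded vertex has no incoming edges
besides the images of those it has in the part. -/
theorem Embeds.ins_map {wire : Tail n h S M ≃ Head n k S M} {w : Tail n a S' M' ≃ Head n b S' M'}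
    {f : Fin a → Tail n h S M} {f' : Fin b → Head n k S M} {σ : S' → S} {μ : M' → M}
    (he : Embeds wire w f f' σ μ) (v : S' ⊕ M') :
    ins wire (Sum.map σ μ v) = (ins w v).map (tailMap f σ μ) := by
  rcases v with s | m
  · simp [ins, Equiv.symm_apply_eq, he _, headMap]
  · simp only [Sum.map_inr, ins, List.map_ofFn, Function.comp_def]
    congr 1
    funext i
    simp [Equiv.symm_apply_eq, he _, headMap]

theorem embeds_upper {l : ℕ} (w : Tail n h S M ≃ Head n k S M)
    (w' : Tail n k S' M' ≃ Head n l S' M') :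
    Embeds (StrandDiagram.concatWire w w') w Tail.source
      (fun j => StrandDiagram.lowerHead (w' (.source j))) Sum.inl Sum.inl := by
  intro t
  rw [tailMap_source]
  refine (StrandDiagram.concatWire_upper w w' t).trans ?_
  rcases w t with _ | _ | _ <;> rfl

theorem embeds_lower {l : ℕ} (w : Tail n h S M ≃ Head n k S M)
    (w' : Tail n k S' M' ≃ Head n l S' M') :
    Embeds (StrandDiagram.concatWire w w') w'
      (fun j => StrandDiagram.upperTail (w.symm (.sink j))) Head.sink Sum.inr Sum.inr := by
  intro t
  rw [headMap_sink]
  refine Eq.trans ?_ (StrandDiagram.concatWire_lower w w' t)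
  congr 1

end Embedding

/-! ### Redexes, and the laws of concatenation up to isotopy -/

namespace StrandDiagram

variable {n h k l r : ℕ}

/-- Both kinds of redex take the single form `outs v = ins w`. Conversely, this equation excludes
two splits or two merges, because the lengths `n` and `1` differ. -/
theorem not_reduced_iff (hn : 2 ≤ n) {A : StrandDiagram n h k} :
    ¬ A.Reduced ↔ ∃ v w, outs v = ins A.wire w := by
  constructor
  · intro hA
    by_contra! hc
    refine hA ⟨fun s m hsm => hc (.inl s) (.inr m) ?_, fun m s hms => hc (.inr m) (.inl s) ?_⟩
    · simp only [outs, ins]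
      congr 1
      funext i
      rw [← hsm i, Equiv.symm_apply_apply]
    · simp only [outs, ins]
      rw [← hms, Equiv.symm_apply_apply]
  · rintro ⟨s | m, s' | m', he⟩ hA
    · have := congrArg List.length he
      simp [outs, ins] at this
      omega
    · refine hA.1 s m' fun i => ?_
      have := congrFun (List.ofFn_injective he) i
      rw [this, Equiv.apply_symm_apply]
    · refine hA.2 m s' ?_
      rw [IsMergeSplit, List.singleton_inj.1 he, Equiv.apply_symm_apply]
    · have := congrArg List.length he
      simp [outs, ins] at this
      omega

namespace Isotopic

theorem refl (A : StrandDiagram n h k) : Isotopic A A :=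
  ⟨Equiv.refl _, Equiv.refl _, fun t => by
    have h₁ : t.map (Equiv.refl A.Split) (Equiv.refl A.Merge) = t := by
      rcases t with _ | _ | _ <;> rfl
    rw [h₁]
    rcases A.wire t with _ | _ | _ <;> rfl⟩

theorem symm {A B : StrandDiagram n h k} (hAB : Isotopic A B) : Isotopic B A := by
  obtain ⟨σ, μ, hw⟩ := hAB
  refine ⟨σ.symm, μ.symm, fun t => ?_⟩
  have h₁ : (t.map σ.symm μ.symm).map σ μ = t := by rcases t with _ | _ | _ <;> simp [Tail.map]
  have h₂ := hw (t.map σ.symm μ.symm)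
  rw [h₁] at h₂
  rw [h₂]
  rcases A.wire (t.map σ.symm μ.symm) with _ | _ | _ <;> simp [Head.map]

theorem trans {A B C : StrandDiagram n h k} (hAB : Isotopic A B) (hBC : Isotopic B C) :
    Isotopic A C := by
  obtain ⟨σ, μ, hw⟩ := hAB
  obtain ⟨σ', μ', hw'⟩ := hBC
  refine ⟨σ.trans σ', μ.trans μ', fun t => ?_⟩
  have h₁ : t.map (σ.trans σ') (μ.trans μ') = (t.map σ μ).map σ' μ' := by
    rcases t with _ | _ | _ <;> rfl
  rw [h₁, hw', hw]
  rcases A.wire t with _ | _ | _ <;> rfl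

/-- `step_concat_left` yields only a `Step`, which might be a reduction. Transporting redexes and
sizes requires an isotopy. -/
theorem concat_left {A B : StrandDiagram n h k} (hAB : Isotopic A B) (C : StrandDiagram n k l) :
    Isotopic (A.concat C) (B.concat C) := by
  obtain ⟨σ, μ, hw⟩ := hAB
  refine ⟨σ.sumCongr (Equiv.refl _), μ.sumCongr (Equiv.refl _), fun t => ?_⟩
  change concatWire B.wire C.wire (t.map (Sum.map σ id) (Sum.map μ id)) =
    (concatWire A.wire C.wire t).map (Sum.map σ id) (Sum.map μ id)
  rcases upper_cases A.wire t with ⟨t', rfl⟩ | ⟨s, i, rfl⟩ | ⟨m, rfl⟩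
  · rw [map_upperTail, concatWire_upper, concatWire_upper, hw, map_upperHead]
  · rw [concatWire_lower, map_lowerHead]; rfl
  · rw [concatWire_lower, map_lowerHead]; rfl

theorem concat_right (C : StrandDiagram n h k) {A B : StrandDiagram n k l} (hAB : Isotopic A B) :
    Isotopic (C.concat A) (C.concat B) := by
  obtain ⟨σ, μ, hw⟩ := hAB
  refine ⟨(Equiv.refl _).sumCongr σ, (Equiv.refl _).sumCongr μ, fun t => ?_⟩
  change concatWire C.wire B.wire (t.map (Sum.map id σ) (Sum.map id μ)) =
    (concatWire C.wire A.wire t).map (Sum.map id σ) (Sum.map id μ)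
  rcases lower_cases C.wire t with ⟨t', rfl⟩ | ⟨t', s, rfl, ht⟩ | ⟨t', m, i, rfl, ht⟩
  · rw [map_lowerTail, concatWire_lower, concatWire_lower, hw, map_inr_lowerHead]
  · rw [map_inl_upperTail, concatWire_upper, concatWire_upper, ht]; rfl
  · rw [map_inl_upperTail, concatWire_upper, concatWire_upper, ht]; rfl

theorem concat_congr {A A' : StrandDiagram n h k} {B B' : StrandDiagram n k l}
    (hA : Isotopic A A') (hB : Isotopic B B') : Isotopic (A.concat B) (A'.concat B') :=
  (hA.concat_left B).trans (concat_right A' hB)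

theorem not_reduced (hn : 2 ≤ n) {A B : StrandDiagram n h k} (hAB : Isotopic A B)
    (hA : ¬ A.Reduced) : ¬ B.Reduced := by
  obtain ⟨σ, μ, hw⟩ := hAB
  rw [not_reduced_iff hn] at hA ⊢
  obtain ⟨v, w, he⟩ := hA
  have hE : Embeds B.wire A.wire Tail.source Head.sink σ μ := by
    intro t
    rw [tailMap_source, headMap_sink, hw]
  exact ⟨Sum.map σ μ v, Sum.map σ μ w, by rw [hE.ins_map, outs_map Tail.source, he]⟩

theorem reduced (hn : 2 ≤ n) {A B : StrandDiagram n h k} (hAB : Isotopic A B)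
    (hA : A.Reduced) : B.Reduced := by
  by_contra hB
  exact hAB.symm.not_reduced hn hB hA

end Isotopic

theorem concat_assoc (A : StrandDiagram n h k) (B : StrandDiagram n k l)
    (C : StrandDiagram n l r) : Isotopic ((A.concat B).concat C) (A.concat (B.concat C)) := by
  have h₀ : ∀ y : Head n r C.Split C.Merge,
      (lowerHead (S := A.Split ⊕ B.Split) (M := A.Merge ⊕ B.Merge) y).map
        (Equiv.sumAssoc _ _ _) (Equiv.sumAssoc _ _ _) = lowerHead (lowerHead y) := by
    rintro (_ | _ | _) <;> rfl
  have h₁ : ∀ y : Head n l B.Split B.Merge,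
      (upperHead C.wire (lowerHead (S := A.Split) (M := A.Merge) y)).map
        (Equiv.sumAssoc _ _ _) (Equiv.sumAssoc _ _ _) = lowerHead (upperHead C.wire y) := by
    rintro (_ | _ | _)
    · exact h₀ _
    · rfl
    · rfl
  have h₂ : ∀ x : Head n k A.Split A.Merge,
      (upperHead C.wire (upperHead B.wire x)).map
        (Equiv.sumAssoc _ _ _) (Equiv.sumAssoc _ _ _) =
        upperHead (concatWire B.wire C.wire) x := by
    rintro (_ | _ | _)
    · exact h₁ _
    · rfl
    · rfl
  refine ⟨Equiv.sumAssoc _ _ _, Equiv.sumAssoc _ _ _, ?_⟩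
  rintro (i | ⟨(s | s) | s, i⟩ | ((m | m) | m))
  · exact (h₂ _).symm
  · exact (h₂ _).symm
  · exact (h₁ _).symm
  · exact (h₀ _).symm
  · exact (h₂ _).symm
  · exact (h₁ _).symm
  · exact (h₀ _).symm

theorem one_concat (A : StrandDiagram n h k) : Isotopic ((one n h).concat A) A := by
  have h₀ : ∀ y : Head n k A.Split A.Merge, (lowerHead (S := Empty) (M := Empty) y).map
      (Equiv.emptySum Empty _) (Equiv.emptySum Empty _) = y := by
    rintro (_ | _ | _) <;> rfl
  refine ⟨Equiv.emptySum Empty _, Equiv.emptySum Empty _, ?_⟩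
  rintro (i | ⟨⟨⟨⟩⟩ | s, i⟩ | (⟨⟨⟩⟩ | m))
  · exact (h₀ _).symm
  · exact (h₀ _).symm
  · exact (h₀ _).symm

theorem concat_one (A : StrandDiagram n h k) : Isotopic (A.concat (one n k)) A := by
  have h₀ : ∀ y : Head n k A.Split A.Merge, (upperHead (one n k).wire y).map
      (Equiv.sumEmpty _ Empty) (Equiv.sumEmpty _ Empty) = y := by
    rintro (_ | _ | _) <;> rfl
  refine ⟨Equiv.sumEmpty _ Empty, Equiv.sumEmpty _ Empty, ?_⟩
  rintro (i | ⟨s | ⟨⟨⟩⟩, i⟩ | (m | ⟨⟨⟩⟩))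
  · exact (h₀ _).symm
  · exact (h₀ _).symm
  · exact (h₀ _).symm

theorem reflect_reflect (A : StrandDiagram n h k) : Isotopic A.reflect.reflect A := by
  refine ⟨Equiv.refl _, Equiv.refl _, fun t => ?_⟩
  have h₁ : reflectWire (reflectWire A.wire) = A.wire := by
    ext t
    simp [reflectWire]
  change A.wire (t.map id id) = (reflectWire (reflectWire A.wire) t).map id id
  rw [h₁]
  have h₂ : t.map id id = t := by rcases t with _ | _ | _ <;> rfl
  refine (congrArg A.wire h₂).trans ?_
  rcases A.wire t with _ | _ | _ <;> rfl

theorem reflect_concat (A : StrandDiagram n h k) (B : StrandDiagram n k l) :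
    Isotopic (A.concat B).reflect (B.reflect.concat A.reflect) := by
  have h₀ : ∀ x : Tail n h A.Split A.Merge,
      (reflectTail (upperTail (S' := B.Split) (M' := B.Merge) x)).map
        (Equiv.sumComm _ _) (Equiv.sumComm _ _) = lowerHead (reflectTail x) := by
    rintro (_ | _ | _) <;> rfl
  have h₁ : ∀ x : Tail n k B.Split B.Merge, (reflectTail (lowerTail A.wire x)).map
      (Equiv.sumComm _ _) (Equiv.sumComm _ _) =
      upperHead (reflectWire A.wire) (reflectTail x) := by
    rintro (_ | _ | _)
    · exact h₀ _
    · rfl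
    · rfl
  refine ⟨Equiv.sumComm _ _, Equiv.sumComm _ _, ?_⟩
  rintro (i | ⟨s | s, i⟩ | (m | m))
  · exact (h₁ _).symm
  · exact (h₀ _).symm
  · exact (h₁ _).symm
  · exact (h₀ _).symm
  · exact (h₁ _).symm

theorem reflect_one : Isotopic (one n k).reflect (one n k) := by
  refine ⟨Equiv.refl _, Equiv.refl _, ?_⟩
  rintro (i | ⟨⟨⟩, i⟩ | ⟨⟨⟩⟩)
  rfl

theorem pow_congr {A B : StrandDiagram n k k} (hAB : Isotopic A B) (p : ℕ) :
    Isotopic (A.pow p) (B.pow p) := by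
  induction p with
  | zero => exact Isotopic.refl _
  | succ p ih => exact ih.concat_congr hAB

/-- This is mere regrouping, with no reduction involved, so a redex on one side is a redex on the
other. -/
theorem pow_concat_comm (X : StrandDiagram n h k) (Y : StrandDiagram n k h) (p : ℕ) :
    Isotopic (((X.concat Y).pow p).concat X) (X.concat ((Y.concat X).pow p)) := by
  induction p with
  | zero => exact (one_concat X).trans (concat_one X).symm
  | succ p ih =>
    refine (concat_assoc _ _ _).trans ?_
    refine (Isotopic.concat_right _ (concat_assoc X Y X)).trans ?_
    refine (concat_assoc _ _ _).symm.trans ?_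
    exact (ih.concat_left _).trans (concat_assoc _ _ _)

end StrandDiagram

/-! ### Groupoid laws for classes -/

namespace StrandClass

open StrandDiagram

variable {n h k l r : ℕ}

theorem mk_eq_of_step {A B : StrandDiagram n h k} (hAB : Step A B) : mk A = mk B :=
  Quotient.sound (Relation.EqvGen.rel _ _ hAB)

theorem mk_eq_of_isotopic {A B : StrandDiagram n h k} (hAB : Isotopic A B) : mk A = mk B :=
  mk_eq_of_step (Or.inl hAB)

theorem mk_concat (A : StrandDiagram n h k) (B : StrandDiagram n k l) :
    mk (A.concat B) = (mk A).comp (mk B) := rfl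

theorem mk_reflect (A : StrandDiagram n h k) : mk A.reflect = (mk A).inv := rfl

theorem comp_assoc (f : StrandClass n h k) (g : StrandClass n k l) (e : StrandClass n l r) :
    (f.comp g).comp e = f.comp (g.comp e) := by
  induction f using Quotient.inductionOn
  induction g using Quotient.inductionOn
  induction e using Quotient.inductionOn
  exact mk_eq_of_isotopic (concat_assoc _ _ _)

theorem one_comp (f : StrandClass n h k) : (mk (one n h)).comp f = f := by
  induction f using Quotient.inductionOn
  exact mk_eq_of_isotopic (one_concat _)

theorem comp_one (f : StrandClass n h k) : f.comp (mk (one n k)) = f := by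
  induction f using Quotient.inductionOn
  exact mk_eq_of_isotopic (concat_one _)

theorem inv_comp (f : StrandClass n h k) (g : StrandClass n k l) :
    (f.comp g).inv = g.inv.comp f.inv := by
  induction f using Quotient.inductionOn
  induction g using Quotient.inductionOn
  exact mk_eq_of_isotopic (reflect_concat _ _)

end StrandClass

/-! ### Diagrams with a single vertex, and the size of a diagram -/

namespace StrandDiagram

variable {n h k : ℕ}

section Elementary

variable (n a b : ℕ)

/-- The wiring of a single split with `a` edges to the left of it and `b` edges to the right. -/
def elementaryWire : Tail n (a + 1 + b) Unit Empty ≃ Head n (a + n + b) Unit Empty where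
  toFun
    | .source i => Fin.addCases
        (Fin.addCases (fun i => .sink (Fin.castAdd b (Fin.castAdd n i))) fun _ => .toSplit ())
        (fun i => .sink (Fin.natAdd (a + n) i)) i
    | .ofSplit _ i => .sink (Fin.castAdd b (Fin.natAdd a i))
  invFun
    | .sink i => Fin.addCases
        (Fin.addCases (fun i => .source (Fin.castAdd b (Fin.castAdd 1 i))) fun i => .ofSplit () i)
        (fun i => .source (Fin.natAdd (a + 1) i)) i
    | .toSplit _ => .source (Fin.castAdd b (Fin.natAdd a 0))
  left_inv := by
    rintro (i | ⟨⟨⟩, i⟩ | ⟨⟨⟩⟩)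
    · refine Fin.addCases (fun i => ?_) (fun i => ?_) i
      · refine Fin.addCases (fun i => ?_) (fun i => ?_) i
        · simp
        · simp [Subsingleton.elim i 0]
      · simp
    · simp
  right_inv := by
    rintro (i | ⟨⟨⟩⟩ | ⟨⟨⟩, _⟩)
    · refine Fin.addCases (fun i => ?_) (fun i => ?_) i
      · refine Fin.addCases (fun i => ?_) (fun i => ?_) i <;> simp
      · simp
    · simp

section Apply

variable {n a b}

theorem elementaryWire_left (i : Fin a) :
    elementaryWire n a b (.source (Fin.castAdd b (Fin.castAdd 1 i))) =
      .sink (Fin.castAdd b (Fin.castAdd n i)) := by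
  simp [elementaryWire]

theorem elementaryWire_middle (i : Fin 1) :
    elementaryWire n a b (.source (Fin.castAdd b (Fin.natAdd a i))) = .toSplit () := by
  simp [elementaryWire]

theorem elementaryWire_right (i : Fin b) :
    elementaryWire n a b (.source (Fin.natAdd (a + 1) i)) = .sink (Fin.natAdd (a + n) i) := by
  simp [elementaryWire]

theorem elementaryWire_ofSplit (i : Fin n) :
    elementaryWire n a b (.ofSplit () i) = .sink (Fin.castAdd b (Fin.natAdd a i)) := rfl

theorem reflectWire_eq_iff {S M : Type} {w : Tail n h S M ≃ Head n k S M} {t : Tail n k M S}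
    {x : Head n h M S} : reflectWire w t = x ↔ w (reflectTail.symm x) = reflectTail t := by
  change reflectTail (w.symm (reflectTail t)) = x ↔ _
  rw [← Equiv.eq_symm_apply, Equiv.symm_apply_eq, eq_comm]

theorem reflect_elementaryWire_left (i : Fin a) :
    reflectWire (elementaryWire n a b) (.source (Fin.castAdd b (Fin.castAdd n i))) =
      .sink (Fin.castAdd b (Fin.castAdd 1 i)) :=
  reflectWire_eq_iff.2 (elementaryWire_left i)

theorem reflect_elementaryWire_middle (i : Fin n) :
    reflectWire (elementaryWire n a b) (.source (Fin.castAdd b (Fin.natAdd a i))) =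
      .toMerge () i :=
  reflectWire_eq_iff.2 (elementaryWire_ofSplit i)

theorem reflect_elementaryWire_right (i : Fin b) :
    reflectWire (elementaryWire n a b) (.source (Fin.natAdd (a + n) i)) =
      .sink (Fin.natAdd (a + 1) i) :=
  reflectWire_eq_iff.2 (elementaryWire_right i)

theorem reflect_elementaryWire_ofMerge (i : Fin 1) :
    reflectWire (elementaryWire n a b) (.ofMerge ()) = .sink (Fin.castAdd b (Fin.natAdd a i)) :=
  reflectWire_eq_iff.2 (elementaryWire_middle i)

end Apply

/-- A single split with `a` edges to the left of it and `b` edges to the right. -/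
def elementary : StrandDiagram n (a + 1 + b) (a + n + b) where
  Split := Unit
  Merge := Empty
  finite_split := inferInstance
  finite_merge := inferInstance
  wire := elementaryWire n a b
  acyclic := by
    intro v hv
    obtain ⟨w, ⟨t, ht, hw⟩, -⟩ := Relation.TransGen.head'_iff.1 hv
    rcases t with i | ⟨⟨⟩, i⟩ | ⟨⟨⟩⟩
    · simp [Tail.vertex?] at ht
    · simp [elementaryWire_ofSplit, Head.vertex?] at hw
  plane := by
    refine ⟨[.inl ()], List.nodup_singleton _, by simp, ?_⟩
    have h₁ : (elementaryWire n a b).symm (.toSplit ()) =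
        .source (Fin.castAdd b (Fin.natAdd a 0)) :=
      (Equiv.symm_apply_eq _).2 (elementaryWire_middle 0).symm
    have h₂ : ∀ i : Fin a, (elementaryWire n a b).symm
        (.sink (Fin.castAdd b (Fin.castAdd n i))) = .source (Fin.castAdd b (Fin.castAdd 1 i)) :=
      fun i => (Equiv.symm_apply_eq _).2 (elementaryWire_left i).symm
    have h₃ : ∀ i : Fin b, (elementaryWire n a b).symm (.sink (Fin.natAdd (a + n) i)) =
        .source (Fin.natAdd (a + 1) i) :=
      fun i => (Equiv.symm_apply_eq _).2 (elementaryWire_right i).symm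
    have h₄ : ∀ i : Fin n, (elementaryWire n a b).symm (.sink (Fin.castAdd b (Fin.natAdd a i))) =
        .ofSplit () i :=
      fun i => (Equiv.symm_apply_eq _).2 (elementaryWire_ofSplit i).symm
    have := Sweep.split (wire := elementaryWire n a b) () []
      (List.ofFn fun i => .source (Fin.castAdd b (Fin.castAdd 1 i)))
      (List.ofFn fun i => .source (Fin.natAdd (a + 1) i)) _ (Sweep.nil _)
    rw [h₁] at this
    convert this using 1
    · rw [List.ofFn_add, List.ofFn_add]
      rfl
    · rw [List.ofFn_add, List.ofFn_add]
      exact congrArg₂ _ (congrArg₂ _ (congrArg List.ofFn (funext h₂))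
        (congrArg List.ofFn (funext h₄))) (congrArg List.ofFn (funext h₃))

/-- A single type I reduction removes both vertices. With the type II counterpart
`reflect_concat_elementary`, the class of a one-vertex diagram is invertible, with the class of the
mirror image as its inverse. -/
theorem elementary_concat_reflect :
    StrandClass.mk ((elementary n a b).concat (elementary n a b).reflect) =
      StrandClass.mk (one n _) := by
  have h₀ : ∀ i : Fin n, concatWire (elementaryWire n a b) (reflectWire (elementaryWire n a b))
      (.ofSplit (.inl ()) i) = .toMerge (.inr ()) i := fun i =>
    (concatWire_upper _ _ (.ofSplit () i)).trans
      (congrArg lowerHead (reflect_elementaryWire_middle i))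
  refine StrandClass.mk_eq_of_step (Or.inr (Or.inl ⟨.inl (), .inr (), Empty.elim, Empty.elim,
    h₀, ⟨fun x => x.elim, ?_⟩, ⟨fun x => x.elim, ?_⟩, ?_⟩))
  · rintro (⟨⟨⟩⟩ | ⟨⟨⟩⟩)
    exact iff_of_false (fun ⟨x, _⟩ => x.elim) (fun h' => h' rfl)
  · rintro (⟨⟨⟩⟩ | ⟨⟨⟩⟩)
    exact iff_of_false (fun ⟨x, _⟩ => x.elim) (fun h' => h' rfl)
  · rintro (i | ⟨⟨⟩, i⟩ | ⟨⟨⟩⟩)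
    refine Fin.addCases (fun i => ?_) (fun i => ?_) i
    · refine Fin.addCases (fun i => ?_) (fun i => ?_) i
      · exact Or.inl ((congrArg (upperHead _) (elementaryWire_left i)).trans
          (congrArg lowerHead (reflect_elementaryWire_left i)))
      -- Only the middle strand meets the deleted pair; all others run straight through.
      · exact Or.inr ⟨congrArg (upperHead _) (elementaryWire_middle i),
          congrArg lowerHead (reflect_elementaryWire_ofMerge i)⟩
    · exact Or.inl ((congrArg (upperHead _) (elementaryWire_right i)).trans
        (congrArg lowerHead (reflect_elementaryWire_right i)))

theorem reflect_concat_elementary :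
    StrandClass.mk ((elementary n a b).reflect.concat (elementary n a b)) =
      StrandClass.mk (one n _) := by
  have h₀ : concatWire (reflectWire (elementaryWire n a b)) (elementaryWire n a b)
      (.ofMerge (.inl ())) = .toSplit (.inr ()) :=
    (congrArg (upperHead _) (reflect_elementaryWire_ofMerge 0)).trans
      (congrArg lowerHead (elementaryWire_middle 0))
  refine StrandClass.mk_eq_of_step (Or.inr (Or.inr ⟨.inr (), .inl (), Empty.elim, Empty.elim,
    h₀, ⟨fun x => x.elim, ?_⟩, ⟨fun x => x.elim, ?_⟩, ?_⟩))
  · rintro (⟨⟨⟩⟩ | ⟨⟨⟩⟩)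
    exact iff_of_false (fun ⟨x, _⟩ => x.elim) (fun h' => h' rfl)
  · rintro (⟨⟨⟩⟩ | ⟨⟨⟩⟩)
    exact iff_of_false (fun ⟨x, _⟩ => x.elim) (fun h' => h' rfl)
  · rintro (i | ⟨⟨⟩, i⟩ | ⟨⟨⟩⟩)
    refine Fin.addCases (fun i => ?_) (fun i => ?_) i
    · refine Fin.addCases (fun i => ?_) (fun i => ?_) i
      · exact Or.inl ((congrArg (upperHead _) (reflect_elementaryWire_left i)).trans
          (congrArg lowerHead (elementaryWire_left i)))
      · exact Or.inr ⟨i, congrArg (upperHead _) (reflect_elementaryWire_middle i),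
          congrArg lowerHead (elementaryWire_ofSplit i)⟩
    · exact Or.inl ((congrArg (upperHead _) (reflect_elementaryWire_right i)).trans
        (congrArg lowerHead (elementaryWire_right i)))

end Elementary

/-- The number of splits and merges. -/
noncomputable def size (A : StrandDiagram n h k) : ℕ := Nat.card A.Split + Nat.card A.Merge

theorem Isotopic.size_eq {A B : StrandDiagram n h k} (hAB : Isotopic A B) : A.size = B.size := by
  obtain ⟨σ, μ, -⟩ := hAB
  rw [size, size, Nat.card_congr σ, Nat.card_congr μ]

theorem size_concat {l : ℕ} (A : StrandDiagram n h k) (B : StrandDiagram n k l) :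
    (A.concat B).size = A.size + B.size := by
  have := A.finite_split
  have := A.finite_merge
  have := B.finite_split
  have := B.finite_merge
  have h₁ : Nat.card (A.concat B).Split = Nat.card A.Split + Nat.card B.Split := Nat.card_sum
  have h₂ : Nat.card (A.concat B).Merge = Nat.card A.Merge + Nat.card B.Merge := Nat.card_sum
  rw [size, size, size, h₁, h₂]
  omega

theorem size_elementary (a b : ℕ) : (elementary n a b).size = 1 := by
  have h₁ : Nat.card (elementary n a b).Split = 1 := Nat.card_unique (α := Unit)
  have h₂ : Nat.card (elementary n a b).Merge = 0 := Nat.card_of_isEmpty (α := Empty)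
  rw [size, h₁, h₂]

/-! ### Pieces of a diagram between two positions of the line -/

section Realizes

variable {S M : Type} {a b c : ℕ}

/-- The diagram `D` is the part, with vertices `vs`, of a diagram between two positions of a
horizontal line, at which the line crosses the edges `f` and `f'`. -/
structure Realizes (wire : Tail n h S M ≃ Head n k S M) (vs : List (S ⊕ M))
    (f : Fin a → Tail n h S M) (f' : Fin b → Tail n h S M) (D : StrandDiagram n a b)
    (σ : D.Split → S) (μ : D.Merge → M) : Prop where
  embeds : Embeds wire D.wire f (fun j => wire (f' j)) σ μ
  injective : Function.Injective (Sum.map σ μ)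
  mem_iff : ∀ v, v ∈ vs ↔ v ∈ Set.range (Sum.map σ μ)

variable {wire : Tail n h S M ≃ Head n k S M} {vs ws : List (S ⊕ M)} {f : Fin a → Tail n h S M}
  {f' : Fin b → Tail n h S M} {f'' : Fin c → Tail n h S M}

theorem realizes_one (f : Fin a → Tail n h S M) :
    Realizes wire [] f f (one n a) Empty.elim Empty.elim where
  embeds := by
    rintro (i | ⟨⟨⟩, _⟩ | ⟨⟨⟩⟩)
    rfl
  injective := by rintro (⟨⟨⟩⟩ | ⟨⟨⟩⟩)
  mem_iff v := by
    simp only [List.not_mem_nil, Set.mem_range, false_iff, not_exists]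
    rintro (⟨⟨⟩⟩ | ⟨⟨⟩⟩)

/-- The pieces share the middle position `f'` of the line, so their wirings fit together.
Disjointness of the vertex lists keeps the joint vertex map injective. -/
theorem Realizes.concat {D : StrandDiagram n a b} {E : StrandDiagram n b c} {σ : D.Split → S}
    {μ : D.Merge → M} {σ' : E.Split → S} {μ' : E.Merge → M} (hD : Realizes wire vs f f' D σ μ)
    (hE : Realizes wire ws f' f'' E σ' μ') (hd : vs.Disjoint ws) :
    Realizes wire (vs ++ ws) f f'' (D.concat E) (Sum.elim σ σ') (Sum.elim μ μ') where
  embeds := by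
    have hl : ∀ y : Head n c E.Split E.Merge,
        headMap (fun j => wire (f'' j)) (Sum.elim σ σ') (Sum.elim μ μ') (lowerHead y) =
          headMap (fun j => wire (f'' j)) σ' μ' y := by
      rintro (_ | _ | _) <;> rfl
    intro t
    change _ = headMap _ _ _ (concatWire D.wire E.wire t)
    rcases upper_cases D.wire t with ⟨t, rfl⟩ | ⟨s, i, rfl⟩ | ⟨m, rfl⟩
    · have h₁ : tailMap f (Sum.elim σ σ') (Sum.elim μ μ') (upperTail t) = tailMap f σ μ t := by
        rcases t with _ | _ | _ <;> rfl
      refine (congrArg wire h₁).trans ?_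
      rw [concatWire_upper, hD.embeds]
      rcases D.wire t with j | s | ⟨m, i⟩
      · exact (hE.embeds (.source j)).trans (hl _).symm
      · rfl
      · rfl
    · rw [concatWire_lower, hl]
      exact hE.embeds (.ofSplit s i)
    · rw [concatWire_lower, hl]
      exact hE.embeds (.ofMerge m)
  injective := by
    have hne : ∀ x y, Sum.map σ μ x ≠ Sum.map σ' μ' y := fun x y hxy =>
      hd ((hD.mem_iff _).2 ⟨x, rfl⟩) ((hE.mem_iff _).2 ⟨y, hxy.symm⟩)
    have hσ := Sum.map_injective.1 hD.injective
    have hσ' := Sum.map_injective.1 hE.injective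
    refine Sum.map_injective.2 ⟨hσ.1.sumElim hσ'.1 fun x y hxy => ?_,
      hσ.2.sumElim hσ'.2 fun x y hxy => ?_⟩
    · exact hne (.inl x) (.inl y) (congrArg Sum.inl hxy)
    · exact hne (.inr x) (.inr y) (congrArg Sum.inr hxy)
  mem_iff v := by
    rw [List.mem_append, hD.mem_iff, hE.mem_iff]
    constructor
    · rintro (⟨s | m, rfl⟩ | ⟨s | m, rfl⟩)
      · exact ⟨.inl (.inl s), rfl⟩
      · exact ⟨.inr (.inl m), rfl⟩
      · exact ⟨.inl (.inr s), rfl⟩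
      · exact ⟨.inr (.inr m), rfl⟩
    · rintro ⟨(s | s) | (m | m), rfl⟩
      · exact Or.inl ⟨.inl s, rfl⟩
      · exact Or.inr ⟨.inl s, rfl⟩
      · exact Or.inl ⟨.inr m, rfl⟩
      · exact Or.inr ⟨.inr m, rfl⟩

theorem embeds_elementaryWire (s : S) (l : Fin a → Tail n h S M) (r : Fin b → Tail n h S M) :
    Embeds wire (elementaryWire n a b)
      (Fin.append (Fin.append l fun _ : Fin 1 => wire.symm (.toSplit s)) r)
      (fun j => wire (Fin.append (Fin.append l fun i => .ofSplit s i) r j))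
      (fun _ => s) Empty.elim := by
  rintro (i | ⟨⟨⟩, i⟩ | ⟨⟨⟩⟩)
  · refine Fin.addCases (fun i => ?_) (fun i => ?_) i
    · refine Fin.addCases (fun i => ?_) (fun i => ?_) i
      · simp [elementaryWire_left, tailMap, headMap]
      · rw [elementaryWire_middle]
        simp [tailMap, headMap]
    · simp [elementaryWire_right, tailMap, headMap]
  · simp [elementaryWire_ofSplit, tailMap, headMap]

theorem embeds_reflect_elementaryWire (m : M) (l : Fin a → Tail n h S M)
    (r : Fin b → Tail n h S M) :
    Embeds wire (reflectWire (elementaryWire n a b))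
      (Fin.append (Fin.append l fun i => wire.symm (.toMerge m i)) r)
      (fun j => wire (Fin.append (Fin.append l fun _ : Fin 1 => .ofMerge m) r j))
      Empty.elim (fun _ => m) := by
  rintro (i | ⟨⟨⟩, i⟩ | ⟨⟨⟩⟩)
  · refine Fin.addCases (fun i => ?_) (fun i => ?_) i
    · refine Fin.addCases (fun i => ?_) (fun i => ?_) i
      · simp [reflect_elementaryWire_left, tailMap, headMap]
      · simp [reflect_elementaryWire_middle, tailMap, headMap]
    · simp [reflect_elementaryWire_right, tailMap, headMap]
  · rw [reflect_elementaryWire_ofMerge 0]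
    simp [tailMap, headMap]

theorem realizes_split (s : S) (l : Fin a → Tail n h S M) (r : Fin b → Tail n h S M) :
    Realizes wire [.inl s]
      (Fin.append (Fin.append l fun _ : Fin 1 => wire.symm (.toSplit s)) r)
      (Fin.append (Fin.append l fun i => .ofSplit s i) r)
      (elementary n a b) (fun _ => s) Empty.elim where
  embeds := embeds_elementaryWire s l r
  injective := by
    rintro (⟨⟨⟩⟩ | ⟨⟨⟩⟩) (⟨⟨⟩⟩ | ⟨⟨⟩⟩) _
    rfl
  mem_iff v := by
    rw [List.mem_singleton]
    constructor
    · rintro rfl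
      exact ⟨.inl (), rfl⟩
    · rintro ⟨⟨⟨⟩⟩ | ⟨⟨⟩⟩, rfl⟩
      rfl

theorem realizes_merge (m : M) (l : Fin a → Tail n h S M) (r : Fin b → Tail n h S M) :
    Realizes wire [.inr m]
      (Fin.append (Fin.append l fun i => wire.symm (.toMerge m i)) r)
      (Fin.append (Fin.append l fun _ : Fin 1 => .ofMerge m) r)
      (elementary n a b).reflect Empty.elim (fun _ => m) where
  embeds := embeds_reflect_elementaryWire m l r
  injective := by
    rintro (⟨⟨⟩⟩ | ⟨⟨⟩⟩) (⟨⟨⟩⟩ | ⟨⟨⟩⟩) _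
    rfl
  mem_iff v := by
    rw [List.mem_singleton]
    constructor
    · rintro rfl
      exact ⟨.inr (), rfl⟩
    · rintro ⟨⟨⟨⟩⟩ | ⟨⟨⟩⟩, rfl⟩
      rfl

end Realizes

end StrandDiagram

/-! ### Factoring a diagram along a sweep -/

theorem List.ofFn_append_append {α : Type*} (L R : List α) {c : ℕ} (g : Fin c → α) :
    List.ofFn (Fin.append (Fin.append L.get g) R.get) = L ++ List.ofFn g ++ R := by
  rw [List.ofFn_fin_append, List.ofFn_fin_append, List.ofFn_get, List.ofFn_get]

/-- The equality is heterogeneous because the width `a` is only propositionally the sum of lengths;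
after substituting the first component it becomes an ordinary equation. -/
theorem List.eq_append_append_of_ofFn_eq {α : Type*} {L R : List α} {a c : ℕ} {f : Fin a → α}
    {g : Fin c → α} (hf : List.ofFn f = L ++ List.ofFn g ++ R) :
    a = L.length + c + R.length ∧ HEq f (Fin.append (Fin.append L.get g) R.get) := by
  rw [← List.ofFn_append_append] at hf
  obtain rfl : a = L.length + c + R.length := by
    have := congrArg List.length hf
    rwa [List.length_ofFn, List.length_ofFn] at this
  exact ⟨rfl, heq_of_eq (List.ofFn_injective hf)⟩

namespace StrandDiagram

variable {n h k l : ℕ}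

section Realization

variable {S M : Type} {wire : Tail n h S M ≃ Head n k S M}

/-- Passing a vertex is realized by a diagram with one vertex, which is invertible. -/
theorem exists_realizes_vertex (v : S ⊕ M) {L R : List (Tail n h S M)} {a : ℕ}
    {f : Fin a → Tail n h S M} (hf : List.ofFn f = L ++ ins wire v ++ R) :
    ∃ (b : ℕ) (f' : Fin b → Tail n h S M) (X : StrandDiagram n a b) (σ : X.Split → S)
      (μ : X.Merge → M), List.ofFn f' = L ++ outs v ++ R ∧ Realizes wire [v] f f' X σ μ ∧
      (StrandClass.mk X).comp (StrandClass.mk X).inv = StrandClass.mk (one n a) := by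
  rcases v with s | m
  · obtain ⟨rfl, hf⟩ := List.eq_append_append_of_ofFn_eq (L := L) (R := R)
      (g := fun _ : Fin 1 => wire.symm (.toSplit s)) (hf.trans (by simp [ins]))
    obtain rfl := eq_of_heq hf
    exact ⟨_, _, elementary n _ _, _, _, by rw [List.ofFn_append_append]; simp [outs],
      realizes_split s L.get R.get, elementary_concat_reflect _ _ _⟩
  · obtain ⟨rfl, hf⟩ := List.eq_append_append_of_ofFn_eq hf
    obtain rfl := eq_of_heq hf
    refine ⟨_, _, (elementary n _ _).reflect, _, _, by rw [List.ofFn_append_append]; simp [outs],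
      realizes_merge m L.get R.get, ?_⟩
    refine Eq.trans ?_ (reflect_concat_elementary _ _ _)
    rw [StrandClass.mk_concat, ← StrandClass.mk_reflect,
      StrandClass.mk_eq_of_isotopic (reflect_reflect _)]

/-- Passing a vertex and then a vertex that can be cancelled with it is realized by a
trivial element. -/
theorem exists_realizes_cancel (hn : 2 ≤ n) {v w : S ⊕ M} (hvw : outs v = ins wire w)
    {L R : List (Tail n h S M)} {a : ℕ} {f : Fin a → Tail n h S M}
    (hf : List.ofFn f = L ++ ins wire v ++ R) :
    ∃ (f' : Fin a → Tail n h S M) (X : StrandDiagram n a a) (σ : X.Split → S)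
      (μ : X.Merge → M), List.ofFn f' = L ++ outs w ++ R ∧ Realizes wire [v, w] f f' X σ μ ∧
      0 < X.size ∧ StrandClass.mk X = StrandClass.mk (one n a) := by
  have hlen := congrArg List.length hvw
  rcases v with s | m <;> rcases w with s' | m'
  · simp [outs, ins] at hlen
    omega
  · obtain ⟨rfl, hf⟩ := List.eq_append_append_of_ofFn_eq (L := L) (R := R)
      (g := fun _ : Fin 1 => wire.symm (.toSplit s)) (hf.trans (by simp [ins]))
    obtain rfl := eq_of_heq hf
    -- The line just below the split is the line just above the merge, so the two one-vertex pieces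
    -- can be glued.
    have h₁ : (fun i => Tail.ofSplit s i) = fun i => wire.symm (.toMerge m' i) :=
      List.ofFn_injective hvw
    have h₂ := realizes_split (wire := wire) s L.get R.get
    rw [h₁] at h₂
    exact ⟨_, _, _, _, by rw [List.ofFn_append_append]; simp [outs],
      h₂.concat (realizes_merge m' L.get R.get) (by simp),
      by rw [size_concat, size_elementary]; omega, elementary_concat_reflect _ _ _⟩
  · obtain ⟨rfl, hf⟩ := List.eq_append_append_of_ofFn_eq hf
    obtain rfl := eq_of_heq hf
    have h₁ : Tail.ofMerge m = wire.symm (.toSplit s') := List.singleton_inj.1 hvw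
    have h₂ := realizes_merge (wire := wire) m L.get R.get
    rw [h₁] at h₂
    exact ⟨_, _, _, _, by rw [List.ofFn_append_append]; simp [outs],
      h₂.concat (realizes_split s' L.get R.get) (by simp),
      by rw [size_concat, size_elementary]; omega, reflect_concat_elementary _ _ _⟩
  · simp [outs, ins] at hlen
    omega

/-- One one-vertex diagram is stacked for each vertex passed. Planarity and acyclicity of `D` then
come from concatenation and need no separate check. -/
theorem exists_realizes {vs : List (S ⊕ M)} {L L' : List (Tail n h S M)}
    (hs : Sweep wire vs L L') (hvs : vs.Nodup) {a b : ℕ} {f : Fin a → Tail n h S M}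
    {f' : Fin b → Tail n h S M} (hf : List.ofFn f = L) (hf' : List.ofFn f' = L') :
    ∃ (D : StrandDiagram n a b) (σ : D.Split → S) (μ : D.Merge → M),
      Realizes wire vs f f' D σ μ := by
  induction vs generalizing L a with
  | nil =>
    obtain rfl := hs.of_nil
    rw [← hf] at hf'
    obtain rfl : b = a := by simpa using congrArg List.length hf'
    obtain rfl := List.ofFn_injective hf'
    exact ⟨_, _, _, realizes_one _⟩
  | cons v vs ih =>
    obtain ⟨A, B, rfl, hs'⟩ := hs.of_cons
    obtain ⟨c, f₁, X, σ, μ, hf₁, hX, -⟩ := exists_realizes_vertex v hf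
    obtain ⟨hv, hvs⟩ := List.nodup_cons.1 hvs
    obtain ⟨D, σ', μ', hD⟩ := ih hs' hvs hf₁
    exact ⟨_, _, _, hX.concat hD (by simpa using hv)⟩

/-- When the list exhausts the vertices, the injective vertex maps are bijective. A full sweep thus
presents the diagram, up to isotopy, as a product of one-vertex diagrams. -/
theorem Realizes.isotopic {A : StrandDiagram n h k} {vs : List (A.Split ⊕ A.Merge)}
    {D : StrandDiagram n h k} {σ : D.Split → A.Split} {μ : D.Merge → A.Merge}
    (hD : Realizes A.wire vs Tail.source (fun j => A.wire.symm (.sink j)) D σ μ)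
    (hvs : ∀ v, v ∈ vs) : Isotopic D A := by
  obtain ⟨hσ, hμ⟩ := Sum.map_injective.1 hD.injective
  have hσ' : Function.Surjective σ := fun s => by
    obtain ⟨x | x, hx⟩ := (hD.mem_iff _).1 (hvs (.inl s))
    · exact ⟨x, Sum.inl_injective hx⟩
    · cases hx
  have hμ' : Function.Surjective μ := fun m => by
    obtain ⟨x | x, hx⟩ := (hD.mem_iff _).1 (hvs (.inr m))
    · cases hx
    · exact ⟨x, Sum.inr_injective hx⟩
  refine ⟨Equiv.ofBijective σ ⟨hσ, hσ'⟩, Equiv.ofBijective μ ⟨hμ, hμ'⟩, fun t => ?_⟩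
  have := hD.embeds t
  simp only [Equiv.apply_symm_apply] at this
  rwa [tailMap_source, headMap_sink] at this

end Realization

/-- Every diagram that is not reduced is equivalent to a smaller one. -/
theorem exists_size_lt (hn : 2 ≤ n) {A : StrandDiagram n h k} (hA : ¬ A.Reduced) :
    ∃ B : StrandDiagram n h k, StrandClass.mk B = StrandClass.mk A ∧ B.size < A.size := by
  obtain ⟨v, w, hvw⟩ := (not_reduced_iff hn).1 hA
  obtain ⟨vs, hvs, hall, hs⟩ := A.plane
  -- Once `v` and `w` are consecutive, the diagram is cut above `v` and below `w` into three
  -- factors, and the middle one can be dropped.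
  obtain ⟨a, c, hd, hall, L, R, h₁, h₂⟩ := hs.exists_adjacent (by omega) hvs hall hvw
  have hd' := List.nodup_append'.1 hd
  have hdc : c.Nodup := (List.nodup_cons.1 (List.nodup_cons.1 hd'.2.1).2).2
  obtain ⟨D₁, σ₁, μ₁, hD₁⟩ := exists_realizes h₁ hd'.1 rfl (List.ofFn_get _)
  obtain ⟨f, D₂, σ₂, μ₂, hf, hD₂, hpos, hone⟩ := exists_realizes_cancel hn hvw
    (List.ofFn_get (L ++ ins A.wire v ++ R))
  obtain ⟨D₃, σ₃, μ₃, hD₃⟩ := exists_realizes h₂ hdc hf rfl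
  have h₂₃ := hD₂.concat hD₃ (by
    have h₄ := hd'.2.1
    simp only [List.nodup_cons, List.mem_cons, not_or] at h₄
    simp [h₄.1.2, h₄.2.1])
  have hiso := (hD₁.concat h₂₃ (by simpa using hd'.2.2)).isotopic (by simpa using hall)
  refine ⟨D₁.concat D₃, ?_, ?_⟩
  · rw [← StrandClass.mk_eq_of_isotopic hiso, StrandClass.mk_concat, StrandClass.mk_concat,
      StrandClass.mk_concat, hone, StrandClass.one_comp]
  · rw [← hiso.size_eq, size_concat, size_concat, size_concat]
    omega

/-- A vertex all of whose incoming edges start at sources can be split off at the top. -/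
theorem exists_isotopic_concat (hn : n ≠ 0) (A : StrandDiagram n h k) (w : A.Split ⊕ A.Merge)
    {js : List (Fin h)} (hw : ins A.wire w = js.map Tail.source) :
    ∃ (b : ℕ) (X : StrandDiagram n h b) (Y : StrandDiagram n b k),
      Isotopic A (X.concat Y) ∧ 0 < b ∧
      (StrandClass.mk X).comp (StrandClass.mk X).inv = StrandClass.mk (one n h) ∧
      (∀ x : X.Split ⊕ X.Merge, x.isLeft = w.isLeft) ∧
      ∃ w', ins X.wire w' = js.map Tail.source := by
  obtain ⟨vs, hvs, hall, hs⟩ := A.plane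
  -- Only source edges enter `w`, so no vertex has to be passed before it.
  obtain ⟨ws, hd, hmem, hs⟩ := hs.exists_cons hn hvs (hall w) (fun v t ht ht' => by
    rw [hw, List.mem_map] at ht'
    obtain ⟨j, -, rfl⟩ := ht'
    exact source_not_mem_outs _ _ ht)
  obtain ⟨L, R, he, hs⟩ := hs.of_cons
  obtain ⟨b, f, X, σ, μ, hf, hX, hinv⟩ := exists_realizes_vertex w he
  obtain ⟨hw₀, hd⟩ := List.nodup_cons.1 hd
  obtain ⟨Y, σ', μ', hY⟩ := exists_realizes hs hd hf rfl
  refine ⟨b, X, Y, ?_, ?_, hinv, ?_, ?_⟩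
  · refine ((hX.concat hY (by simpa using hw₀)).isotopic fun v => ?_).symm
    exact (hmem v).1 (hall v)
  · have h₁ := congrArg List.length hf
    have h₂ := List.length_pos_of_ne_nil (outs_ne_nil (n := n) (h := h) hn w)
    simp only [List.length_ofFn, List.length_append] at h₁
    omega
  · intro x
    have hx := (hX.mem_iff _).2 ⟨x, rfl⟩
    rw [← List.mem_singleton.1 hx]
    rcases x with _ | _ <;> rfl
  · obtain ⟨w', hw'⟩ := (hX.mem_iff w).1 (by simp)
    refine ⟨w', ?_⟩
    -- The embedding of `X` fixes source edges and is injective on edges, so the same list `js`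
    -- describes the edges into the vertex of `X`.
    rw [← hw', hX.embeds.ins_map] at hw
    have h₁ : (js.map Tail.source).map (tailMap (n := n) (h := h) Tail.source σ μ) =
        js.map Tail.source := by simp [tailMap]
    obtain ⟨hσ, hμ⟩ := Sum.map_injective.1 hX.injective
    refine List.map_injective_iff.2 ?_ (hw.trans h₁.symm)
    rintro (_ | _ | _) (_ | _ | _) hxy <;> simp [tailMap, hσ.eq_iff, hμ.eq_iff] at hxy ⊢ <;>
      exact hxy

/-- The diagram can be reduced at a vertex `w` and the vertex above it, where `w` is a split
or a merge according to `β`. -/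
def HasRedex (A : StrandDiagram n h k) (β : Bool) : Prop :=
  ∃ v w, outs v = ins A.wire w ∧ w.isLeft = β

/-- Two vertices of the same kind would equate the lengths `n` and `1`. That a redex always pairs
opposite kinds is what later keeps its upper vertex out of `X`. -/
theorem isLeft_of_outs_eq_ins (hn : 2 ≤ n) {S M : Type} {wire : Tail n h S M ≃ Head n k S M}
    {v w : S ⊕ M} (hvw : outs v = ins wire w) : v.isLeft ≠ w.isLeft := by
  have hlen := congrArg List.length hvw
  rcases v with s | m <;> rcases w with s' | m' <;> simp [outs, ins] at hlen ⊢ <;> omega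

theorem HasRedex.of_isotopic {A B : StrandDiagram n h k} {β : Bool} (hA : A.HasRedex β)
    (hAB : Isotopic A B) : B.HasRedex β := by
  obtain ⟨σ, μ, hw⟩ := hAB
  obtain ⟨v, w, he, rfl⟩ := hA
  have hE : Embeds B.wire A.wire Tail.source Head.sink σ μ := by
    intro t
    rw [tailMap_source, headMap_sink, hw]
  exact ⟨Sum.map σ μ v, Sum.map σ μ w, by rw [hE.ins_map, outs_map Tail.source, he],
    by rcases w with _ | _ <;> rfl⟩

/-! ### Position of a redex in a concatenation -/

section ConcatRedex

variable {S M S' M' : Type} {a : Tail n h S M ≃ Head n k S M} {b : Tail n k S' M' ≃ Head n l S' M'}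

theorem upperTail_injective :
    Function.Injective (upperTail : Tail n h S M → Tail n h (S ⊕ S') (M ⊕ M')) := by
  rintro (_ | _ | _) (_ | _ | _) hxy <;> simp_all [upperTail, Tail.map]

theorem lowerTail_injective :
    Function.Injective (lowerTail a : Tail n k S' M' → Tail n h (S ⊕ S') (M ⊕ M')) := by
  rintro (i | _ | _) (j | _ | _) hxy
  · simpa using a.symm.injective (upperTail_injective hxy)
  · rw [lowerTail, lowerTail] at hxy
    generalize a.symm (.sink i) = y at hxy
    rcases y with _ | _ | _ <;> simp [upperTail, Tail.map] at hxy
  · rw [lowerTail, lowerTail] at hxy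
    generalize a.symm (.sink i) = y at hxy
    rcases y with _ | _ | _ <;> simp [upperTail, Tail.map] at hxy
  · rw [lowerTail, lowerTail] at hxy
    generalize a.symm (.sink j) = y at hxy
    rcases y with _ | _ | _ <;> simp [upperTail, Tail.map] at hxy
  · simpa [lowerTail] using hxy
  · simp [lowerTail] at hxy
  · rw [lowerTail, lowerTail] at hxy
    generalize a.symm (.sink j) = y at hxy
    rcases y with _ | _ | _ <;> simp [upperTail, Tail.map] at hxy
  · simp [lowerTail] at hxy
  · simpa [lowerTail] using hxy

theorem outs_upper (v : S ⊕ M) : outs (Sum.map Sum.inl Sum.inl v : (S ⊕ S') ⊕ (M ⊕ M')) =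
    (outs v).map (upperTail (n := n) (h := h)) := by
  rw [outs_map Tail.source, tailMap_source]
  rfl

theorem ins_upper (v : S ⊕ M) :
    ins (concatWire a b) (Sum.map Sum.inl Sum.inl v) = (ins a v).map upperTail := by
  rw [(embeds_upper a b).ins_map, tailMap_source]
  rfl

theorem tailMap_lower :
    tailMap (fun j => upperTail (a.symm (.sink j))) Sum.inr Sum.inr =
      (lowerTail a : Tail n k S' M' → Tail n h (S ⊕ S') (M ⊕ M')) := by
  funext t
  rcases t with _ | _ | _ <;> rfl

theorem outs_lower (v : S' ⊕ M') : outs (Sum.map Sum.inr Sum.inr v : (S ⊕ S') ⊕ (M ⊕ M')) =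
    (outs v).map (lowerTail a) := by
  rw [outs_map fun j => upperTail (a.symm (.sink j)), tailMap_lower]

theorem ins_lower (v : S' ⊕ M') :
    ins (concatWire a b) (Sum.map Sum.inr Sum.inr v) = (ins b v).map (lowerTail a) := by
  rw [(embeds_lower a b).ins_map, tailMap_lower]

theorem exists_sum_map (v : (S ⊕ S') ⊕ (M ⊕ M')) :
    (∃ u : S ⊕ M, v = Sum.map Sum.inl Sum.inl u) ∨
      ∃ u : S' ⊕ M', v = Sum.map Sum.inr Sum.inr u := by
  rcases v with (s | s) | (m | m)
  · exact Or.inl ⟨.inl s, rfl⟩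
  · exact Or.inr ⟨.inl s, rfl⟩
  · exact Or.inl ⟨.inr m, rfl⟩
  · exact Or.inr ⟨.inr m, rfl⟩

theorem isLeft_map {f : S → S'} {g : M → M'} (v : S ⊕ M) :
    (Sum.map f g v).isLeft = v.isLeft := by
  rcases v with _ | _ <;> rfl

theorem exists_source_of_lowerTail_eq {x : Tail n k S' M'} {y : Tail n h S M}
    (hxy : lowerTail a x = upperTail y) : ∃ j, x = .source j := by
  rcases x with j | _ | _
  · exact ⟨j, rfl⟩
  · rcases y with _ | _ | _ <;> simp [lowerTail, upperTail, Tail.map] at hxy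
  · rcases y with _ | _ | _ <;> simp [lowerTail, upperTail, Tail.map] at hxy

/-- An edge of the lower factor that is also an edge of the upper one must be glued at a source, but
no edge out of a vertex starts at a source. -/
theorem outs_lower_ne_ins_upper (hn : n ≠ 0) (v : S' ⊕ M') (w : S ⊕ M) :
    outs (Sum.map Sum.inr Sum.inr v) ≠ ins (concatWire a b) (Sum.map Sum.inl Sum.inl w) := by
  intro he
  obtain ⟨t, ht⟩ := List.exists_mem_of_ne_nil _ (outs_ne_nil (n := n) (h := k) hn v)
  rw [outs_lower (a := a), ins_upper] at he
  have h₁ : lowerTail a t ∈ (ins a w).map (upperTail (S' := S') (M' := M')) :=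
    he ▸ List.mem_map_of_mem ht
  obtain ⟨y, -, hy⟩ := List.mem_map.1 h₁
  obtain ⟨j, rfl⟩ := exists_source_of_lowerTail_eq hy.symm
  exact source_not_mem_outs _ _ ht

/-- The lower vertex enters only through the list `js` of sources feeding it. The lower factor may
therefore be replaced by any other one having a vertex with the same `js`, in particular by its top
piece `X`. -/
theorem outs_upper_eq_ins_lower_iff (v : S ⊕ M) (w : S' ⊕ M') :
    outs (Sum.map Sum.inl Sum.inl v) = ins (concatWire a b) (Sum.map Sum.inr Sum.inr w) ↔
      ∃ js : List (Fin k), ins b w = js.map Tail.source ∧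
        outs v = js.map fun j => a.symm (.sink j) := by
  have h₀ : ∀ js : List (Fin k), (js.map Tail.source).map (lowerTail (S' := S') (M' := M') a) =
      (js.map fun j => a.symm (.sink j)).map upperTail := fun js => by
    simp [lowerTail]
  rw [outs_upper, ins_lower]
  constructor
  · intro he
    have h₁ : ins b w ∈ Set.range (List.map (Tail.source (n := n) (h := k))) := by
      rw [Set.range_list_map]
      intro t ht
      have h₂ : lowerTail a t ∈ (outs v).map (upperTail (S' := S') (M' := M')) :=
        he ▸ List.mem_map_of_mem ht
      obtain ⟨y, -, hy⟩ := List.mem_map.1 h₂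
      obtain ⟨j, rfl⟩ := exists_source_of_lowerTail_eq hy.symm
      exact ⟨j, rfl⟩
    obtain ⟨js, hjs⟩ := h₁
    rw [← hjs, h₀] at he
    exact ⟨js, hjs.symm, List.map_injective_iff.2 upperTail_injective he⟩
  · rintro ⟨js, h₁, h₂⟩
    rw [h₁, h₂, h₀]

end ConcatRedex

/-! ### The minimality argument -/

theorem one_reduced : (one n k).Reduced := ⟨fun s => s.elim, fun m => m.elim⟩

/-- A redex that involves no vertex of the first factor. -/
theorem HasRedex.of_concat (hn : 2 ≤ n) {X : StrandDiagram n h k} {A : StrandDiagram n k l}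
    {β : Bool} (hX : ∀ x : X.Split ⊕ X.Merge, x.isLeft = β) (hXA : (X.concat A).HasRedex β) :
    ¬ A.Reduced := by
  obtain ⟨v, w, hvw, hw⟩ := hXA
  have hv := isLeft_of_outs_eq_ins hn hvw
  rcases exists_sum_map v with ⟨v, rfl⟩ | ⟨v, rfl⟩
  -- If `v` were in `X`, it would have the same kind as `w`, which no redex allows.
  · refine (hv ?_).elim
    exact (isLeft_map v).trans ((hX v).trans hw.symm)
  · rcases exists_sum_map w with ⟨w, rfl⟩ | ⟨w, rfl⟩
    · exact (outs_lower_ne_ins_upper (by omega) v w hvw).elim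
    · have h₁ := (outs_lower (a := X.wire) v).symm.trans (hvw.trans (ins_lower w))
      exact (not_reduced_iff hn).2 ⟨v, w, List.map_injective_iff.2 lowerTail_injective h₁⟩

/-- In a conjugacy class of minimal size, all powers are reduced. -/
theorem pow_reduced_of_minimal (hn : 2 ≤ n) {g : StrandClass n h h} {N : ℕ}
    (hmin : ∀ (m : ℕ) (S : StrandDiagram n h m) (E : StrandDiagram n m m), 0 < m →
      g = ((StrandClass.mk S).comp (StrandClass.mk E)).comp (StrandClass.mk S).inv → N ≤ E.size)
    (p : ℕ) {m : ℕ} (S : StrandDiagram n h m) (E : StrandDiagram n m m) (hm : 0 < m)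
    (hg : g = ((StrandClass.mk S).comp (StrandClass.mk E)).comp (StrandClass.mk S).inv)
    (hE : E.size = N) : (E.pow p).Reduced := by
  -- The diagrams `S` and `E` vary along with `m`, since the induction hypothesis is also needed for
  -- the conjugate `Y.concat X`, whose width may differ.
  induction p generalizing m with
  | zero => exact one_reduced
  | succ p ih =>
    by_contra hred
    obtain ⟨v, w, hvw⟩ := (not_reduced_iff hn).1 hred
    rcases exists_sum_map w with ⟨w, rfl⟩ | ⟨w, rfl⟩ <;>
      rcases exists_sum_map v with ⟨v, rfl⟩ | ⟨v, rfl⟩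
    · have h₁ := (outs_upper v).symm.trans (hvw.trans (ins_upper w))
      exact (not_reduced_iff hn).2 ⟨v, w, List.map_injective_iff.2 upperTail_injective h₁⟩
        (ih S E hm hg hE)
    · exact outs_lower_ne_ins_upper (by omega) v w hvw
    -- The essential case: the redex straddles the seam between `E^p` and the last copy of `E`, and
    -- `w` is peeled off that copy.
    · obtain ⟨js, hw, hv⟩ := (outs_upper_eq_ins_lower_iff v w).1 hvw
      obtain ⟨b, X, Y, hiso, hb, hinv, hX, w', hw'⟩ := exists_isotopic_concat (by omega) E w hw
      have hred' : ((E.pow p).concat X).HasRedex w.isLeft :=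
        ⟨_, _, (outs_upper_eq_ins_lower_iff v w').2 ⟨js, hw', hv⟩, (isLeft_map w').trans (hX w')⟩
      -- `E^p X` is isotopic to `X (YX)^p`, and an isotopy preserves the kind of the lower vertex.
      have hred₂ := hred'.of_isotopic
        (((pow_congr hiso p).concat_left X).trans (pow_concat_comm X Y p))
      refine hred₂.of_concat hn hX (ih (S.concat X) (Y.concat X) hb ?_ ?_)
      -- `[SX][YX][SX]⁻¹` collapses to `[S][XY][S]⁻¹` because `[X][X]⁻¹ = 1`.
      · rw [hg, StrandClass.mk_eq_of_isotopic hiso]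
        simp only [StrandClass.mk_concat, StrandClass.inv_comp, StrandClass.comp_assoc]
        rw [← StrandClass.comp_assoc (StrandClass.mk X) (StrandClass.mk X).inv, hinv,
          StrandClass.one_comp]
      · rw [← hE, hiso.size_eq, size_concat, size_concat, Nat.add_comm]
    -- A redex inside the last copy of `E` contradicts minimality: a smaller diagram has the same
    -- class and can replace `E` with `S` unchanged.
    · have h₁ := (outs_lower (a := (E.pow p).wire) v).symm.trans (hvw.trans (ins_lower w))
      obtain ⟨B, hB, hlt⟩ := exists_size_lt hn ((not_reduced_iff hn).2
        ⟨v, w, List.map_injective_iff.2 lowerTail_injective h₁⟩)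
      have := hmin m S B hm (by rw [hB, hg])
      omega

end StrandDiagram

theorem theorem5p1 (n : ℕ) (hn : 2 ≤ n) (g : BrownThompson n) :
    ∃ (m : ℕ) (S : StrandDiagram n 1 m) (E : StrandDiagram n m m),
      0 < m ∧
      g = ((StrandClass.mk S).comp (StrandClass.mk E)).comp (StrandClass.mk S).inv ∧
      E.Reduced ∧
      (E.concat E).Reduced ∧
      ∀ p : ℕ, (E.pow p).Reduced := by
  classical
  -- A representative exists at all: any `(1,1)`-diagram of `g`, conjugated by the trivial strand.
  have hex : ∃ N m, ∃ (S : StrandDiagram n 1 m) (E : StrandDiagram n m m), 0 < m ∧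
      g = ((StrandClass.mk S).comp (StrandClass.mk E)).comp (StrandClass.mk S).inv ∧
      E.size = N := by
    obtain ⟨A, rfl⟩ := Quotient.exists_rep g
    refine ⟨A.size, 1, StrandDiagram.one n 1, A, Nat.one_pos, ?_, rfl⟩
    rw [← StrandClass.mk_reflect, StrandClass.mk_eq_of_isotopic StrandDiagram.reflect_one,
      StrandClass.one_comp, StrandClass.comp_one]
    rfl
  obtain ⟨m, S, E, hm, hg, hE⟩ := Nat.find_spec hex
  have hpow := fun p => StrandDiagram.pow_reduced_of_minimal hn
    (fun m S E hm hg => Nat.find_min' hex ⟨m, S, E, hm, hg, rfl⟩) p S E hm hg hE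
  -- Powers start from the trivial diagram, so `E.pow 1` and `E.pow 2` are only isotopic to `E` and
  -- `E.concat E`.
  have hone : StrandDiagram.Isotopic (E.pow 1) E := StrandDiagram.one_concat E
  exact ⟨m, S, E, hm, hg, hone.reduced hn (hpow 1), (hone.concat_left E).reduced hn (hpow 2),
    hpow⟩
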